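/- Let $G$ be a countably infinite discrete group acting on $2^G=\{0,1\}^G$ (product topology) by the left shift $(g\cdot w)(h)=w(g^{-1}h)$, let $\mathrm{Free}(2^G)=\{w\in 2^G : g\cdot w\neq w \text{ for all } g\neq 1_G\}$ with the subspace topology, let $K(\mathrm{Free}(2^G))$ be the space of all compact subsets of $\mathrm{Free}(2^G)$ with the Vietoris topology, and let $F(G,2)$ be the orbit equivalence relation of $G$ on $\mathrm{Free}(2^G)$. A map $f$ is a class-bijective homomorphism from an equivalence relation $E$ to an equivalence relation $F$ if it maps $E$-equivalent points to $F$-equivalent points and, for each $x$, restricts to a bijection from $[x]_E$ onto $[f(x)]_F$; for maps between sets on which $G$ acts, class-bijectivity refers to the orbit equivalence relations. For a class $\mathcal K$ of countable structures in a countable relational language $L=(R_i)_{i\in J}$, closed under isomorphism, an equivalence relation $E$ on $X$ is Borel $\mathcal K$-structurable if there are Borel relations $Q_i$ on $X$, of the same arity as $R_i$ and consisting of tuples of pairwise $E$-equivalent points, such that $\langle [x]_E,(Q_i\restriction [x]_E)_{i\in J}\rangle\in\mathcal K$ for every $x\in X$. For a set $K\subseteq \mathrm{Free}(2^G)$ consider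 the following two properties. (a) For every free Borel action of $G$ on a standard Borel space $X$ there exists a $G$-equivariant class-bijective Borel map $f:X\to K$. (b) (The Borel structurability complexity of $F(G,2)$ is achieved on $K$.) For every class $\mathcal K$ as above, $F(G,2)\restriction K$ is Borel $\mathcal K$-structurable if and only if $F(G,2)$ is Borel $\mathcal K$-structurable. Then: 1. Let $I$ be an ideal of subsets of $\mathrm{Free}(2^G)$. Assume that every nonempty perfect set $P\subseteq K(\mathrm{Free}(2^G))$ whose elements are pairwise disjoint $G$-invariant compact subsets of $\mathrm{Free}(2^G)$ satisfies $P\cap I\neq\varnothing$. Then there exists a compact $G$-invariant set $K\subseteq\mathrm{Free}(2^G)$ with $K\in I$ that satisfies (a) and (b). 2. For every Borel probability measure $\mu$ on $\mathrm{Free}(2^G)$ there exists a compact $G$-invariant set $K\subseteq\mathrm{Free}(2^G)$ with $\mu(K)=0$ that satisfies (a) and (b). 3. For every Polish topology $\tau$ on $\mathrm{Free}(2^G)$ whose Borel $\sigma$-algebra is the usual one there exists a set $K\subseteq\mathrm{Free}(2^G)$ that is compact (in the usual topology), $G$-invariant and $\tau$-meager, and that satisfies (a) and (b). -/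

import Mathlib

universe u v

open TopologicalSpace CategoryTheory MeasureTheory
open scoped FirstOrder

namespace FreeShift

/-- The left shift: `(g · w)(h) = w (g⁻¹ h)` for `w ∈ 2^G`. -/
def shift {G : Type u} [Group G] (g : G) (w : G → Bool) : G → Bool :=
  fun h => w (g⁻¹ * h)

/-- `Free(2^G)`: the points of the 2-shift with trivial stabilizer. As a subset of the product
space `G → Bool` it carries the subspace topology and the Borel σ-algebra (`G` is countable). -/
def freePart (G : Type u) [Group G] : Set (G → Bool) :=
  {w | ∀ g : G, g ≠ 1 → shift g w ≠ w}

theorem shift_one {G : Type u} [Group G] (w : G → Bool) : shift 1 w = w := by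
  funext h
  simp [shift]

theorem shift_mul {G : Type u} [Group G] (a b : G) (w : G → Bool) :
    shift (a * b) w = shift a (shift b w) := by
  funext h
  simp [shift, mul_assoc]

theorem shift_mem_freePart {G : Type u} [Group G] (a : G) {w : G → Bool}
    (hw : w ∈ freePart G) : shift a w ∈ freePart G := by
  intro g hg h
  refine hw (a⁻¹ * g * a) ?_ ?_
  · intro h1
    apply hg
    have h2 : g = a * (a⁻¹ * g * a) * a⁻¹ := by group
    rw [h2, h1]
    group
  · rw [shift_mul, shift_mul, h, ← shift_mul, inv_mul_cancel, shift_one]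

/-- The shift action of `G` on `Free(2^G)`. -/
instance freePartAction (G : Type u) [Group G] : MulAction G (freePart G) where
  smul g w := ⟨shift g w.1, shift_mem_freePart g w.2⟩
  one_smul w := Subtype.ext (shift_one w.1)
  mul_smul a b w := Subtype.ext (shift_mul a b w.1)

/-- `S` is a `G`-invariant set. -/
def IsGInvariant (G : Type u) {X : Type v} [Group G] [MulAction G X] (S : Set X) : Prop :=
  ∀ g : G, ∀ x ∈ S, g • x ∈ S

/-- `K ⊆ Free(2^G)` is compact, in the topology inherited from `2^G`, and `G`-invariant. -/
def IsCompactInvariant {G : Type u} [Group G] (K : Set (freePart G)) : Prop :=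
  IsCompact K ∧ IsGInvariant G K

/-- `f` is a class-bijective homomorphism from `E` to `F`: it maps `E`-related points to
`F`-related points and restricts, for each `x`, to a bijection from `[x]_E` onto `[f x]_F`. -/
def IsClassBijective {X : Type u} {Y : Type v} (E : Setoid X) (F : Setoid Y) (f : X → Y) : Prop :=
  (∀ x x' : X, E x x' → F (f x) (f x')) ∧
    ∀ x : X, Set.BijOn f {x' | E x' x} {y | F y (f x)}

/-- `F(G,2)`: the orbit equivalence relation of `G` on `Free(2^G)`. -/
def orbitF (G : Type u) [Group G] : Setoid (freePart G) :=
  MulAction.orbitRel G (freePart G)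

/-- The restriction of `F(G,2)` to a set `K ⊆ Free(2^G)`. -/
def orbitFOn {G : Type u} [Group G] (K : Set (freePart G)) : Setoid K :=
  (orbitF G).comap Subtype.val

/-- Every free Borel action of the countable group `G` on a standard Borel space `X` admits a
`G`-equivariant class-bijective Borel map `X → K`. -/
def ReceivesFreeActions {G : Type u} [Group G] (K : Set (freePart G)) : Prop :=
  ∀ (X : Type v) [MeasurableSpace X] [StandardBorelSpace X] [MulAction G X],
    (∀ g : G, Measurable fun x : X => g • x) →
    (∀ x : X, MulAction.stabilizer G x = ⊥) →
    ∃ f : X → K, Measurable f ∧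
      (∀ (g : G) (x : X), (f (g • x) : freePart G) = g • (f x : freePart G)) ∧
      IsClassBijective (MulAction.orbitRel G X) (orbitFOn K) f

/-- The structure `⟨C, (Q_R ↾ C)_R⟩` that a family of relations on `X`, indexed by the symbols of
a relational language, induces on a subset `C ⊆ X`. -/
@[reducible]
def restrictedStructure (L : FirstOrder.Language.{0, 0}) [L.IsRelational] {X : Type u}
    (Q : ∀ n : ℕ, L.Relations n → Set (Fin n → X)) (C : Set X) : L.Structure C where
  funMap := fun f _ => isEmptyElim f
  RelMap := fun {n} R a => (fun i => (a i : X)) ∈ Q n R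

/-- `E` is Borel `𝒦`-structurable: there are Borel relations `Q_R`, each consisting of tuples of
pairwise `E`-equivalent points, which turn every `E`-class into a structure in `𝒦`. The class `𝒦`
of countable structures, closed under isomorphism, is given by its members with underlying set in
`Type`, so membership in `𝒦` means being isomorphic to one of these. -/
def IsBorelStructurable (L : FirstOrder.Language.{0, 0}) [L.IsRelational]
    (𝒦 : Set (Bundled.{0} L.Structure)) {X : Type u} [MeasurableSpace X] (E : Setoid X) : Prop :=
  ∃ Q : ∀ n : ℕ, L.Relations n → Set (Fin n → X),
    (∀ n R, MeasurableSet (Q n R)) ∧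
    (∀ n R, ∀ a ∈ Q n R, ∀ i j, E (a i) (a j)) ∧
    ∀ x : X, ∃ M ∈ 𝒦,
      letI := restrictedStructure L Q {y | E y x}
      Nonempty ({y | E y x} ≃[L] M)

/-- The Borel structurability complexity of `F(G,2)` is achieved on `K`: for every class `𝒦` of
countable structures in a countable relational language, closed under isomorphism, the restriction
of `F(G,2)` to `K` is Borel `𝒦`-structurable if and only if `F(G,2)` itself is. -/
def AchievesStructurability {G : Type u} [Group G] (K : Set (freePart G)) : Prop :=
  ∀ (L : FirstOrder.Language.{0, 0}) [L.IsRelational], Countable (Σ n, L.Relations n) →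
    ∀ 𝒦 : Set (Bundled.{0} L.Structure), (∀ M ∈ 𝒦, Countable M) →
      (∀ M ∈ 𝒦, ∀ N : Bundled.{0} L.Structure, Nonempty (M ≃[L] N) → N ∈ 𝒦) →
      (IsBorelStructurable L 𝒦 (orbitFOn K) ↔ IsBorelStructurable L 𝒦 (orbitF G))

end FreeShift

/-! The heart of the proof is a Cantor family of pairwise disjoint nonempty compact invariant sets
`K a`, each receiving every free Borel action (`exists_universalFamily`). A smallness notion then
only has to accept one member. A probability measure gives positive mass to at most countably many
disjoint sets. In a Polish topology at most countably many disjoint Borel sets are nonmeager. For an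
ideal, the family is thinned to a Cantor subfamily that is continuous in the Vietoris topology,
whose range is a perfect set. Property (b) follows from (a): structures pull back along a
class-bijective map from the whole free part to `K`, and conversely along the inclusion of `K`.

An equivariant map from `X` to `2^G` is the code of a Borel set `B`. This set is decided in stages,
while a syndetic set of points stays undecided. One stage (`Forces`) must place all codes in a
closed set, whatever is done later on the remaining undecided points. The closed set and the next
syndeticity window depend on the old window alone, never on the action; hence the same compact set
serves all actions. Stage `n` kills one period, so that all limits are free, and writes one bit `a
n`, so that different `a` give disjoint sets.

Both tasks rest on counting. Around sparse markers, a finite window contains at least about `M`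
undecided points, while its size is linear in `M`. Each bad event determines `M` of these bits from
the others, hence has proportion at most `2 ^ (-M)` among the patterns. The number of events is
polynomial in `M`, so for large `M` some pattern avoids them all. For periods, the events are
coincidences with a translate (`exists_aperiodic_modification`). For bits, the parities of `B` on
translates of the old window are used. The bit `true` demands markers where all parities are even,
and the bit `false` demands regions where, at every place such a marker could stand, some parity is
odd (`exists_forces_bit`). -/

namespace FreeShift

open scoped Pointwise Classical

/-! ### Borel combinatorics of free actions -/

section Borel

variable {G : Type u} [Group G] {X : Type v} [MeasurableSpace X] [MulAction G X]

/-- The action of `G` on `X` is free. -/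
def IsFreeAction (G : Type u) (X : Type v) [Group G] [MulAction G X] : Prop :=
  ∀ (g : G) (x : X), g • x = x → g = 1

theorem IsFreeAction.smul_left_inj {G : Type u} {X : Type v} [Group G] [MulAction G X]
    (h : IsFreeAction G X) {a b : G} {x : X} (hab : a • x = b • x) : a = b := by
  have : (b⁻¹ * a) • x = x := by rw [mul_smul, hab, inv_smul_smul]
  have := h _ _ this
  rwa [inv_mul_eq_one, eq_comm] at this

/-- Every translate of every point meets `R` through `W`. -/
def IsSyndetic {G : Type u} {X : Type v} [Group G] [MulAction G X] (W : Finset G)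
    (R : Set X) : Prop :=
  ∀ x : X, ∃ w ∈ W, w • x ∈ R

theorem measurableSet_smul_mem [MeasurableConstSMul G X] {A : Set X} (hA : MeasurableSet A)
    (g : G) : MeasurableSet {x : X | g • x ∈ A} :=
  measurable_const_smul g hA

/-- Embed `X` in the Cantor space and color `x` by its shortest prefix that separates it from all `s
• x`. Equal colors would mean equal prefixes of that same length. -/
theorem exists_coloring [StandardBorelSpace X] [MeasurableConstSMul G X]
    (hfree : IsFreeAction G X) (S : Finset G) (hS : 1 ∉ S) :
    ∃ c : X → ℕ, Measurable c ∧ ∀ x, ∀ s ∈ S, c (s • x) ≠ c x := by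
  obtain ⟨e, he, hinj⟩ := MeasurableSpace.measurable_injection_nat_bool_of_countablySeparated X
  have hmeas : ∀ (g : G) (i : ℕ), Measurable fun x : X => e (g • x) i := fun g i =>
    (measurable_pi_apply i).comp (he.comp (measurable_const_smul g))
  have hmeas1 : ∀ i : ℕ, Measurable fun x : X => e x i := fun i => (measurable_pi_apply i).comp he
  have hex : ∀ x : X, ∃ n : ℕ, ∀ s ∈ S, ∃ i < n, e (s • x) i ≠ e x i := by
    intro x
    have h1 : ∀ s : G, ∃ i, s ∈ S → e (s • x) i ≠ e x i := by
      intro s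
      by_cases hs : s ∈ S
      · have : e (s • x) ≠ e x := fun h => hS (hfree s x (hinj h) ▸ hs)
        obtain ⟨i, hi⟩ := Function.ne_iff.mp this
        exact ⟨i, fun _ => hi⟩
      · exact ⟨0, fun h => absurd h hs⟩
    choose i hi using h1
    exact ⟨S.sup i + 1, fun s hs => ⟨i s, Nat.lt_succ_of_le (Finset.le_sup hs), hi s hs⟩⟩
  let N : X → ℕ := fun x => Nat.find (hex x)
  have hN : Measurable N := by
    refine measurable_find hex fun n => ?_
    have : {x : X | ∀ s ∈ S, ∃ i < n, e (s • x) i ≠ e x i} =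
        ⋂ s ∈ S, ⋃ i, ⋃ (_ : i < n), {x : X | e (s • x) i = e x i}ᶜ := by
      ext x; simp
    rw [this]
    exact Finset.measurableSet_biInter _ fun s _ => MeasurableSet.iUnion fun i =>
      MeasurableSet.iUnion fun _ => (measurableSet_eq_fun (hmeas s i) (hmeas1 i)).compl
  let P : X → ℕ × Finset ℕ := fun x => (N x, (Finset.range (N x)).filter fun i => e x i = true)
  have hP : Measurable fun x => Encodable.encode (P x) := by
    refine measurable_to_countable' fun k => ?_
    have : (fun x => Encodable.encode (P x)) ⁻¹' {k} =
        ⋃ p : ℕ × Finset ℕ, ⋃ (_ : Encodable.encode p = k), {x | N x = p.1} ∩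
          ⋂ i : ℕ, {x | (i < p.1 ∧ e x i = true) ↔ i ∈ p.2} := by
      ext x
      simp only [Set.mem_preimage, Set.mem_singleton_iff, Set.mem_iUnion, Set.mem_inter_iff,
        Set.mem_ofPred_eq, Set.mem_iInter, exists_prop]
      constructor
      · intro h
        exact ⟨P x, h, rfl, fun i => by simp [P]⟩
      · rintro ⟨p, hp, h1, h2⟩
        have : P x = p := by
          refine Prod.ext h1 ?_
          ext i
          simp [P, h1, ← h2]
        rw [this, hp]
    rw [this]
    refine MeasurableSet.iUnion fun p => MeasurableSet.iUnion fun _ =>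
      (hN (measurableSet_singleton _)).inter (MeasurableSet.iInter fun i => ?_)
    have h3 : MeasurableSet {x : X | e x i = true} := hmeas1 i (measurableSet_singleton true)
    by_cases h1 : i < p.1 <;> by_cases h2 : i ∈ p.2 <;> simp only [h1, h2, true_and, false_and,
      iff_true, iff_false]
    · exact h3
    · exact h3.compl
    · exact MeasurableSet.const _
    · exact MeasurableSet.const _
  refine ⟨_, hP, fun x s hs h => ?_⟩
  have h1 : P (s • x) = P x := Encodable.encode_injective h
  have h2 : N (s • x) = N x := congrArg Prod.fst h1
  have h3 := congrArg Prod.snd h1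
  obtain ⟨i, hi, hne⟩ := Nat.find_spec (hex x) s hs
  apply hne
  have h4 := Finset.ext_iff.mp h3 i
  simp only [P, Finset.mem_filter, Finset.mem_range, h2] at h4
  have h5 : i < N x := hi
  simp only [h5, true_and] at h4
  exact Bool.eq_iff_iff.mpr h4

/-- Greedy choice along a coloring: points of one color never conflict, so a whole color class can
be treated at once. -/
theorem exists_maximal_independent [StandardBorelSpace X] [MeasurableConstSMul G X]
    (hfree : IsFreeAction G X) (S : Finset G) (hS : 1 ∉ S) (hinv : ∀ s ∈ S, s⁻¹ ∈ S)
    {R : Set X} (hR : MeasurableSet R) :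
    ∃ D ⊆ R, MeasurableSet D ∧ (∀ x ∈ D, ∀ s ∈ S, s • x ∉ D) ∧
      ∀ x ∈ R, x ∈ D ∨ ∃ s ∈ S, s • x ∈ D := by
  obtain ⟨c, hc, hcs⟩ := exists_coloring hfree S hS
  let M : ℕ → Set X := fun n => Nat.rec ∅
    (fun k M => M ∪ {x | x ∈ R ∧ c x = k ∧ ∀ s ∈ S, s • x ∉ M}) n
  have hM1 : ∀ k, M (k + 1) = M k ∪ {x | x ∈ R ∧ c x = k ∧ ∀ s ∈ S, s • x ∉ M k} := fun k => rfl
  have hmono : Monotone M := monotone_nat_of_le_succ fun k => by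
    rw [hM1]; exact Set.subset_union_left
  have hmeas : ∀ k, MeasurableSet (M k) := by
    intro k
    induction k with
    | zero => exact MeasurableSet.empty
    | succ k ih =>
      rw [hM1]
      refine ih.union (hR.inter ((hc (measurableSet_singleton k)).inter ?_))
      have : {x : X | ∀ s ∈ S, s • x ∉ M k} = ⋂ s ∈ S, {x | s • x ∈ M k}ᶜ := by ext; simp
      refine (congrArg MeasurableSet this).mpr ?_
      exact Finset.measurableSet_biInter _ fun s _ => (measurableSet_smul_mem ih s).compl
  have hcol : ∀ k x, x ∈ M k → x ∈ R ∧ c x < k ∧ ∀ s ∈ S, s • x ∉ M (c x) := by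
    intro k
    induction k with
    | zero => intro x hx; exact absurd hx (Set.notMem_empty x)
    | succ k ih =>
      intro x hx
      rw [hM1] at hx
      rcases hx with hx | ⟨h1, h2, h3⟩
      · obtain ⟨h1, h2, h3⟩ := ih x hx
        exact ⟨h1, by omega, h3⟩
      · subst h2; exact ⟨h1, by omega, h3⟩
  have hself : ∀ k x, x ∈ M k → x ∈ M (c x + 1) := by
    intro k x hx
    obtain ⟨h1, -, h3⟩ := hcol k x hx
    rw [hM1]; exact Or.inr ⟨h1, rfl, h3⟩
  refine ⟨⋃ k, M k, ?_, MeasurableSet.iUnion hmeas, ?_, ?_⟩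
  · exact Set.iUnion_subset fun k x hx => (hcol k x hx).1
  · intro x hx s hs hsx
    obtain ⟨k, hk⟩ := Set.mem_iUnion.mp hx
    obtain ⟨l, hl⟩ := Set.mem_iUnion.mp hsx
    have hne := hcs x s hs
    rcases lt_or_gt_of_ne hne with h | h
    · exact (hcol k x hk).2.2 s hs (hmono (show c (s • x) + 1 ≤ c x from h) (hself l _ hl))
    · refine (hcol l _ hl).2.2 s⁻¹ (hinv s hs) ?_
      rw [inv_smul_smul]
      exact hmono (show c x + 1 ≤ c (s • x) from h) (hself k _ hk)
  · intro x hx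
    rcases Classical.em (∃ s ∈ S, s • x ∈ M (c x)) with h | h
    · obtain ⟨s, hs, h⟩ := h
      exact Or.inr ⟨s, hs, Set.mem_iUnion.mpr ⟨_, h⟩⟩
    · push Not at h
      exact Or.inl (Set.mem_iUnion.mpr ⟨c x + 1, by rw [hM1]; exact Or.inr ⟨hx, rfl, h⟩⟩)

/-- The trace of `B` on the window `F` around `y`. -/
noncomputable def trace (F : Finset G) (B : Set X) (y : X) : Finset G :=
  F.filter fun g => g • y ∈ B

/-- Pointwise existence becomes Borel existence: each marker takes the first admissible pattern in
an enumeration of finite sets. By `hsep` what one marker writes is never read by another, so the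
choices are independent. -/
theorem exists_local_modification [Countable G] [MeasurableConstSMul G X]
    (hfree : IsFreeAction G X) {A V D : Set X} (hA : MeasurableSet A) (hV : MeasurableSet V)
    (hD : MeasurableSet D) {F Q : Finset G}
    (hsep : ∀ y ∈ D, ∀ y' ∈ D, ∀ g ∈ F, ∀ q ∈ Q, g • y = q • y' → y = y')
    (Φ : X → Finset G → Prop) (hΦ : ∀ π, MeasurableSet {y | Φ y π})
    (hex : ∀ y ∈ D, ∃ B : Set X, (∀ x, (x ∉ V ∨ ∀ q ∈ Q, x ≠ q • y) → (x ∈ B ↔ x ∈ A)) ∧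
      Φ y (trace F B y)) :
    ∃ A' : Set X, MeasurableSet A' ∧
      (∀ x, (x ∉ V ∨ ∀ y ∈ D, ∀ q ∈ Q, x ≠ q • y) → (x ∈ A' ↔ x ∈ A)) ∧
      ∀ y ∈ D, Φ y (trace F A' y) := by
  rcases isEmpty_or_nonempty (Finset G) with hE | hE
  · exact (hE.false ∅).elim
  obtain ⟨en, hen⟩ := exists_surjective_nat (Finset G)
  let ok : X → Finset G → Prop := fun y π => y ∈ D → π ⊆ F ∧ Φ y π ∧ ∀ g ∈ F, (g • y ∉ V ∨ g ∉ Q) →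
    (g ∈ π ↔ g • y ∈ A)
  have hok : ∀ y, ∃ n, ok y (en n) := by
    intro y
    by_cases hy : y ∈ D
    · obtain ⟨B, hB, hΦB⟩ := hex y hy
      obtain ⟨n, hn⟩ := hen (trace F B y)
      refine ⟨n, fun _ => ⟨hn ▸ Finset.filter_subset _ _, hn ▸ hΦB, fun g hg h => ?_⟩⟩
      rw [hn, trace, Finset.mem_filter, and_iff_right hg]
      refine hB _ (h.imp_right fun h q hq he => h ?_)
      rwa [hfree.smul_left_inj he]
    · exact ⟨0, fun h => absurd h hy⟩
  have hokm : ∀ π, MeasurableSet {y | ok y π} := by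
    intro π
    have : {y | ok y π} = Dᶜ ∪ ({_y | π ⊆ F} ∩ ({y | Φ y π} ∩ ⋂ g ∈ F, ({y | g • y ∈ V} ∩ {_y | g ∈ Q}) ∪
        ({y | g • y ∈ A} ∩ {_y | g ∈ π}) ∪ ({y | g • y ∈ A}ᶜ ∩ {_y | g ∉ π}))) := by
      ext y
      simp only [ok, Set.mem_ofPred_eq, Set.mem_union, Set.mem_compl_iff, Set.mem_inter_iff,
        Set.mem_iInter]
      rw [imp_iff_not_or]
      refine or_congr Iff.rfl (and_congr Iff.rfl (and_congr Iff.rfl (forall₂_congr fun g _ => ?_)))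
      tauto
    rw [this]
    refine hD.compl.union ((MeasurableSet.const _).inter ((hΦ π).inter
      (Finset.measurableSet_biInter _ fun g _ => ?_)))
    exact (((measurableSet_smul_mem hV g).inter (MeasurableSet.const _)).union
      ((measurableSet_smul_mem hA g).inter (MeasurableSet.const _))).union
      ((measurableSet_smul_mem hA g).compl.inter (MeasurableSet.const _))
  let n : X → ℕ := fun y => Nat.find (hok y)
  have hn : Measurable n := measurable_find hok fun k => hokm (en k)
  have hspec : ∀ y, ok y (en (n y)) := fun y => Nat.find_spec (hok y)
  obtain ⟨A', hA'⟩ : ∃ A' : Set X, A' = {x | (x ∈ A ∧ ¬(x ∈ V ∧ ∃ q ∈ Q, q⁻¹ • x ∈ D)) ∨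
    (x ∈ V ∧ ∃ q ∈ Q, q⁻¹ • x ∈ D ∧ q ∈ en (n (q⁻¹ • x)))} := ⟨_, rfl⟩
  have hmem : ∀ x, x ∈ A' ↔ (x ∈ A ∧ ¬(x ∈ V ∧ ∃ q ∈ Q, q⁻¹ • x ∈ D)) ∨
    (x ∈ V ∧ ∃ q ∈ Q, q⁻¹ • x ∈ D ∧ q ∈ en (n (q⁻¹ • x))) := fun x => by rw [hA']; rfl
  refine ⟨A', ?_, ?_, ?_⟩
  · have h1 : MeasurableSet {x | ∃ q ∈ Q, q⁻¹ • x ∈ D} := by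
      have : {x : X | ∃ q ∈ Q, q⁻¹ • x ∈ D} = ⋃ q ∈ Q, {x | q⁻¹ • x ∈ D} := by ext; simp
      refine (congrArg MeasurableSet this).mpr ?_
      exact Finset.measurableSet_biUnion _ fun q _ => measurableSet_smul_mem hD _
    have h2 : MeasurableSet {x | ∃ q ∈ Q, q⁻¹ • x ∈ D ∧ q ∈ en (n (q⁻¹ • x))} := by
      have : {x : X | ∃ q ∈ Q, q⁻¹ • x ∈ D ∧ q ∈ en (n (q⁻¹ • x))} =
        ⋃ q ∈ Q, {x | q⁻¹ • x ∈ D} ∩ {x | q⁻¹ • x ∈ n ⁻¹' {k | q ∈ en k}} := by ext; simp [and_left_comm]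
      refine (congrArg MeasurableSet this).mpr ?_
      exact Finset.measurableSet_biUnion _ fun q _ => (measurableSet_smul_mem hD _).inter
        (measurableSet_smul_mem (hn (MeasurableSet.of_discrete)) _)
    rw [hA']
    exact (hA.inter (hV.inter h1).compl).union (hV.inter h2)
  · intro x hx
    have h1 : ¬(x ∈ V ∧ ∃ q ∈ Q, q⁻¹ • x ∈ D) := by
      rintro ⟨h1, q, hq, h2⟩
      rcases hx with hx | hx
      · exact hx h1
      · exact hx _ h2 q hq (by rw [smul_inv_smul])
    simp only [hmem, h1, not_false_iff, and_true, or_iff_left_iff_imp]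
    rintro ⟨h2, q, hq, h3, -⟩
    exact (h1 ⟨h2, q, hq, h3⟩).elim
  · intro y hy
    obtain ⟨h0, h1, h2⟩ := hspec y hy
    have key : trace F A' y = F.filter fun g => g ∈ en (n y) := by
      refine Finset.filter_congr fun g hg => ?_
      have huniq : ∀ q ∈ Q, q⁻¹ • g • y ∈ D → q = g ∧ q⁻¹ • g • y = y := by
        intro q hq hqd
        have h3 : y = q⁻¹ • g • y := hsep y hy _ hqd g hg q hq (by rw [smul_inv_smul])
        refine ⟨?_, h3.symm⟩
        have h4 : q • y = g • y := by
          conv_lhs => rw [h3]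
          rw [smul_inv_smul]
        exact hfree.smul_left_inj h4
      by_cases hgV : g • y ∈ V ∧ g ∈ Q
      · have h3 : ∃ q ∈ Q, q⁻¹ • g • y ∈ D := ⟨g, hgV.2, by rwa [inv_smul_smul]⟩
        simp only [hmem, hgV.1, h3, true_and, not_true, and_false, false_or]
        constructor
        · rintro ⟨q, hq, h4, h5⟩
          obtain ⟨h6, h7⟩ := huniq q hq h4
          rw [h7, h6] at h5
          exact h5
        · intro h4
          exact ⟨g, hgV.2, by rwa [inv_smul_smul], by rwa [inv_smul_smul]⟩
      · have h3 : ¬(g • y ∈ V ∧ ∃ q ∈ Q, q⁻¹ • g • y ∈ D) := by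
          rintro ⟨h4, q, hq, h5⟩
          exact hgV ⟨h4, (huniq q hq h5).1 ▸ hq⟩
        rw [h2 g hg (by tauto)]
        simp only [hmem, h3, not_false_iff, and_true, or_iff_left_iff_imp]
        rintro ⟨h4, q, hq, h5, -⟩
        exact (h3 ⟨h4, q, hq, h5⟩).elim
    have h4 : trace F A' y = en (n y) := by
      rw [key]
      ext g
      simp only [Finset.mem_filter, and_iff_right_iff_imp]
      exact fun h => h0 h
    rwa [h4]

theorem exists_limit {A U : ℕ → Set X} (hA : ∀ n, MeasurableSet (A n))
    (hU : ∀ n, MeasurableSet (U n)) (hanti : ∀ n, U (n + 1) ⊆ U n)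
    (hstep : ∀ n, ∀ x ∉ U n, (x ∈ A (n + 1) ↔ x ∈ A n)) :
    ∃ B : Set X, MeasurableSet B ∧ ∀ n, ∀ x ∉ U n, (x ∈ B ↔ x ∈ A n) := by
  have hmono : Antitone U := antitone_nat_of_succ_le hanti
  have h1 : ∀ n m, n ≤ m → ∀ x ∉ U n, (x ∈ A m ↔ x ∈ A n) := by
    intro n m hnm x hx
    induction m, hnm using Nat.le_induction with
    | base => rfl
    | succ m hnm ih => rw [hstep m x fun h => hx (hmono hnm h), ih]
  -- Points that remain undecided forever are left out of the limit.
  refine ⟨⋃ n, A n \ U n, MeasurableSet.iUnion fun n => (hA n).diff (hU n), fun n x hx => ?_⟩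
  simp only [Set.mem_iUnion, Set.mem_sdiff]
  constructor
  · rintro ⟨m, h2, h3⟩
    rcases le_total n m with h | h
    · exact (h1 n m h x hx).mp h2
    · exact (h1 m n h x h3).mpr h2
  · exact fun h => ⟨n, h, hx⟩

end Borel

/-! ### Counting patterns in a window -/

theorem exists_mul_pow_lt_two_pow (C k : ℕ) : ∃ M : ℕ, C * (M + 1) ^ k < 2 ^ M := by
  have h := tendsto_pow_const_div_const_pow_of_one_lt k (r := (2 : ℝ)) one_lt_two
  have h2 : (0 : ℝ) < 1 / (2 * (C + 1)) := by positivity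
  obtain ⟨n, hn1, hn⟩ := ((Filter.eventually_ge_atTop 1).and (h.eventually_lt_const h2)).exists
  obtain ⟨M, rfl⟩ : ∃ M, n = M + 1 := ⟨n - 1, by omega⟩
  refine ⟨M, ?_⟩
  rw [div_lt_div_iff₀ (by positivity) (by positivity), pow_succ (2 : ℝ)] at hn
  have h3 : (0 : ℝ) ≤ ((M + 1 : ℕ) : ℝ) ^ k := by positivity
  have h4 : ((C * (M + 1) ^ k : ℕ) : ℝ) < ((2 ^ M : ℕ) : ℝ) := by
    push_cast at hn h3 ⊢
    nlinarith
  exact_mod_cast h4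

/-- A union bound: a pattern that is bad for `u` is determined by its part outside `J`, so at most
`2 ^ (Q.card - M)` patterns are bad for each of fewer than `2 ^ M` events. -/
theorem exists_subset_avoiding {α ι : Type*} (Q : Finset α) (M : ℕ) (U : Finset ι)
    (Bad : ι → Finset α → Prop) (hU : U.card < 2 ^ M)
    (h : ∀ u ∈ U, ∃ J ⊆ Q, M ≤ J.card ∧
      ∀ p p', p ⊆ Q → p' ⊆ Q → Bad u p → Bad u p' → p \ J = p' \ J → p = p') :
    ∃ p ⊆ Q, ∀ u ∈ U, ¬ Bad u p := by
  by_contra! hcon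
  have h1 : Q.powerset ⊆ U.biUnion fun u => Q.powerset.filter (Bad u) := by
    intro p hp
    obtain ⟨u, hu, hb⟩ := hcon p (Finset.mem_powerset.mp hp)
    exact Finset.mem_biUnion.mpr ⟨u, hu, Finset.mem_filter.mpr ⟨hp, hb⟩⟩
  obtain ⟨u0, hu0, -⟩ := hcon ∅ (Finset.empty_subset _)
  have hMQ : M ≤ Q.card := by
    obtain ⟨J, hJ, hM, -⟩ := h u0 hu0
    exact hM.trans (Finset.card_le_card hJ)
  have h2 : ∀ u ∈ U, (Q.powerset.filter (Bad u)).card ≤ 2 ^ (Q.card - M) := by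
    intro u hu
    obtain ⟨J, hJ, hM, hinj⟩ := h u hu
    calc (Q.powerset.filter (Bad u)).card ≤ (Q \ J).powerset.card := by
          refine Finset.card_le_card_of_injOn (· \ J) ?_ ?_
          · intro p hp
            simp only [Finset.coe_filter, Finset.mem_powerset, Set.mem_ofPred_eq] at hp
            simp only [Finset.coe_powerset, Set.mem_preimage, Set.mem_powerset_iff,
              Finset.coe_subset]
            exact Finset.sdiff_subset_sdiff hp.1 le_rfl
          · intro p hp p' hp' he
            simp only [Finset.coe_filter, Finset.mem_powerset, Set.mem_ofPred_eq] at hp hp'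
            exact hinj p p' hp.1 hp'.1 hp.2 hp'.2 he
      _ = 2 ^ (Q.card - J.card) := by
          rw [Finset.card_powerset, Finset.card_sdiff_of_subset hJ]
      _ ≤ 2 ^ (Q.card - M) := Nat.pow_le_pow_right two_pos (by omega)
  have h3 : 2 ^ Q.card ≤ U.card * 2 ^ (Q.card - M) := by
    rw [← Finset.card_powerset]
    exact (Finset.card_le_card h1).trans (Finset.card_biUnion_le_card_mul _ _ _ h2)
  have h4 : U.card * 2 ^ (Q.card - M) < 2 ^ M * 2 ^ (Q.card - M) :=
    Nat.mul_lt_mul_of_pos_right hU (by positivity)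
  rw [← pow_add, Nat.add_sub_cancel' hMQ] at h4
  omega

variable {G : Type u} [Group G]

/-- For a maximal such `J'`, the three sets `J'`, `J' * u` and `J' * u⁻¹` cover `J`. -/
theorem exists_subset_disjoint_translate (J : Finset G) {u : G} (hu : u ≠ 1) :
    ∃ J' ⊆ J, J.card ≤ 3 * J'.card ∧ ∀ a ∈ J', ∀ b ∈ J', a ≠ b * u := by
  obtain ⟨J', hJ', hmax⟩ := Finset.exists_max_image
    (J.powerset.filter fun K => ∀ a ∈ K, ∀ b ∈ K, a ≠ b * u) Finset.card ⟨∅, by simp⟩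
  simp only [Finset.mem_filter, Finset.mem_powerset] at hJ' hmax
  refine ⟨J', hJ'.1, ?_, hJ'.2⟩
  have hsub : J ⊆ J' ∪ (J'.image (· * u) ∪ J'.image (· * u⁻¹)) := by
    intro q hq
    by_contra hn
    simp only [Finset.mem_union, Finset.mem_image, not_or, not_exists, not_and] at hn
    obtain ⟨h1, h2, h3⟩ := hn
    have h4 := hmax (insert q J') ⟨Finset.insert_subset hq hJ'.1, ?_⟩
    · rw [Finset.card_insert_of_notMem h1] at h4; omega
    · intro a ha b hb hab
      rcases Finset.mem_insert.mp ha with ha' | ha' <;>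
        rcases Finset.mem_insert.mp hb with hb' | hb'
      · exact hu (by simpa [ha', hb'] using hab)
      · exact h2 b hb' (by rw [← hab, ha'])
      · exact h3 a ha' (by rw [hab, mul_inv_cancel_right, hb'])
      · exact hJ'.2 a ha' b hb' hab
  calc J.card ≤ _ := Finset.card_le_card hsub
    _ ≤ J'.card + ((J'.image (· * u)).card + (J'.image (· * u⁻¹)).card) :=
      (Finset.card_union_le _ _).trans (Nat.add_le_add_left (Finset.card_union_le _ _) _)
    _ ≤ 3 * J'.card := by
      have h1 := Finset.card_image_le (s := J') (f := (· * u))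
      have h2 := Finset.card_image_le (s := J') (f := (· * u⁻¹))
      omega

theorem exists_disjoint_translates [Infinite G] (W : Finset G) :
    ∃ c : ℕ → G, (∀ i, ∀ w ∈ W, w * c i ≠ 1) ∧
      ∀ i j, ∀ w ∈ W, ∀ w' ∈ W, w * c i = w' * c j → i = j := by
  obtain ⟨c, hc1, hc2⟩ := exists_seq_of_forall_finset_exists (α := G)
    (fun y => ∀ w ∈ W, w * y ≠ 1) (fun x y => ∀ w ∈ W, ∀ w' ∈ W, w * x ≠ w' * y) (by
      intro s _
      obtain ⟨y, hy⟩ := Infinite.exists_notMem_finset (W⁻¹ ∪ W⁻¹ * (W * s))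
      simp only [Finset.mem_union, not_or] at hy
      refine ⟨y, fun w hw h => hy.1 ?_, fun x hx w hw w' hw' h => hy.2 ?_⟩
      · rw [← inv_eq_of_mul_eq_one_right h]
        exact Finset.inv_mem_inv hw
      · rw [← inv_mul_eq_iff_eq_mul.mpr h]
        exact Finset.mul_mem_mul (Finset.inv_mem_inv hw') (Finset.mul_mem_mul hw hx))
  refine ⟨c, hc1, fun i j w hw w' hw' h => ?_⟩
  rcases lt_trichotomy i j with hij | hij | hij
  · exact (hc2 i j hij w hw w' hw' h).elim
  · exact hij
  · exact (hc2 j i hij w' hw' w hw h.symm).elim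

section

variable {X : Type v} [MulAction G X]

/-- The union bound for sets: only the points of `V` in the window of `y` are free bits, and `J`
must consist of such points. -/
theorem exists_modification_avoiding {ι : Type*} (hfree : IsFreeAction G X) (A V : Set X) (y : X)
    (Q : Finset G) (M : ℕ) (U : Finset ι) (Bad : ι → Set X → Prop) (hU : U.card < 2 ^ M)
    (h : ∀ u ∈ U, ∃ J ⊆ Q, M ≤ J.card ∧ (∀ q ∈ J, q • y ∈ V) ∧
      ∀ B B' : Set X, Bad u B → Bad u B' →
        (∀ x, (∀ q ∈ J, x ≠ q • y) → (x ∈ B ↔ x ∈ B')) → ∀ q ∈ J, (q • y ∈ B ↔ q • y ∈ B')) :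
    ∃ B : Set X, (∀ x, (x ∉ V ∨ ∀ q ∈ Q, x ≠ q • y) → (x ∈ B ↔ x ∈ A)) ∧
      ∀ u ∈ U, ¬ Bad u B := by
  obtain ⟨B, hB⟩ : ∃ B : Finset G → Set X, ∀ p x, x ∈ B p ↔
      (x ∈ A ∧ ¬(x ∈ V ∧ ∃ q ∈ Q, x = q • y)) ∨ (x ∈ V ∧ ∃ q ∈ Q, x = q • y ∧ q ∈ p) :=
    ⟨fun p => {x | (x ∈ A ∧ ¬(x ∈ V ∧ ∃ q ∈ Q, x = q • y)) ∨
      (x ∈ V ∧ ∃ q ∈ Q, x = q • y ∧ q ∈ p)}, fun _ _ => Iff.rfl⟩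
  have hBq : ∀ p, ∀ q ∈ Q, q • y ∈ V → (q • y ∈ B p ↔ q ∈ p) := by
    intro p q hq hqV
    have h1 : ∃ q' ∈ Q, q • y = q' • y := ⟨q, hq, rfl⟩
    simp only [hB, hqV, h1, true_and, not_true, and_false, false_or]
    constructor
    · rintro ⟨q', -, h2, h3⟩
      rwa [hfree.smul_left_inj h2]
    · exact fun h => ⟨q, hq, rfl, h⟩
  have hBcongr : ∀ p p' : Finset G, ∀ x, (∀ q ∈ Q, x = q • y → (q ∈ p ↔ q ∈ p')) →
      (x ∈ B p ↔ x ∈ B p') := by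
    intro p p' x h
    rw [hB, hB]
    refine or_congr Iff.rfl (and_congr Iff.rfl (exists_congr fun q => ?_))
    constructor
    · rintro ⟨h1, h2, h3⟩; exact ⟨h1, h2, (h q h1 h2).mp h3⟩
    · rintro ⟨h1, h2, h3⟩; exact ⟨h1, h2, (h q h1 h2).mpr h3⟩
  obtain ⟨p, -, hp⟩ := exists_subset_avoiding Q M U (fun u p => Bad u (B p)) hU (by
      intro u hu
      obtain ⟨J, hJ, hJc, hJV, hJd⟩ := h u hu
      refine ⟨J, hJ, hJc, ?_⟩
      intro p p' hp hp' hb hb' he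
      have hoff : ∀ q, q ∉ J → (q ∈ p ↔ q ∈ p') := by
        intro q hq
        have := Finset.ext_iff.mp he q
        simpa [hq] using this
      have h1 := hJd _ _ hb hb' fun x hx => hBcongr p p' x fun q hq hxq =>
        hoff q fun hqJ => hx q hqJ hxq
      ext q
      by_cases hq : q ∈ J
      · rw [← hBq p q (hJ hq) (hJV q hq), ← hBq p' q (hJ hq) (hJV q hq), h1 q hq]
      · exact hoff q hq)
  refine ⟨B p, fun x hx => ?_, hp⟩
  have h1 : ¬(x ∈ V ∧ ∃ q ∈ Q, x = q • y) := by
    rintro ⟨h1, q, hq, h2⟩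
    rcases hx with hx | hx
    · exact hx h1
    · exact hx q hq h2
  simp only [hB, h1, not_false_iff, and_true, or_iff_left_iff_imp]
  rintro ⟨h2, q, hq, h3, -⟩
  exact (h1 ⟨h2, q, hq, h3⟩).elim

/-- The comparison of `q • y` with `q • u • y` fixes the first bit from the second, once the second
lies outside the chosen positions. Of `3 * M + 1` free positions at most one is lost to `N`, and a
third of the rest is disjoint from its translate by `u`; thus `M` remain. -/
theorem exists_separating_modification (hfree : IsFreeAction G X) (A V N : Set X) (y : X)
    (Q U : Finset G) (M : ℕ) (hV : 3 * M + 1 ≤ (Q.filter fun q => q • y ∈ V).card)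
    (hN : ∀ u ∈ U, ∀ q ∈ Q, ∀ q' ∈ Q, q • u • y ∈ N → q' • u • y ∈ N → q = q')
    (hU1 : 1 ∉ U) (hU : U.card < 2 ^ M) :
    ∃ B : Set X, (∀ x, (x ∉ V ∨ ∀ q ∈ Q, x ≠ q • y) → (x ∈ B ↔ x ∈ A)) ∧
      ∀ u ∈ U, ∃ q ∈ Q, q • y ∈ V ∧ q • u • y ∉ N ∧ ¬(q • y ∈ B ↔ q • u • y ∈ B) := by
  obtain ⟨B, hB, hBU⟩ := exists_modification_avoiding hfree A V y Q M U
    (fun u B => ∀ q ∈ Q, q • y ∈ V → q • u • y ∉ N → (q • y ∈ B ↔ q • u • y ∈ B)) hU (by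
      intro u hu
      have hu1 : u ≠ 1 := fun h => hU1 (h ▸ hu)
      obtain ⟨J, hJ, hJc, hJd⟩ := exists_subset_disjoint_translate
        ((Q.filter fun q => q • y ∈ V).filter fun q => q • u • y ∉ N) hu1
      have hmemJ : ∀ q ∈ J, q ∈ Q ∧ q • y ∈ V ∧ q • u • y ∉ N := fun q hq => by
        have := hJ hq
        simp only [Finset.mem_filter] at this
        tauto
      refine ⟨J, fun q hq => (hmemJ q hq).1, ?_, fun q hq => (hmemJ q hq).2.1, ?_⟩
      · have h1 : ((Q.filter fun q => q • y ∈ V).filter fun q => ¬ q • u • y ∉ N).card ≤ 1 := by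
          refine Finset.card_le_one.mpr fun a ha b hb => ?_
          simp only [Finset.mem_filter, not_not] at ha hb
          exact hN u hu a ha.1.1 b hb.1.1 ha.2 hb.2
        have h2 := Finset.card_filter_add_card_filter_not (s := Q.filter fun q => q • y ∈ V)
          (fun q => q • u • y ∉ N)
        omega
      · intro B B' hb hb' hoff q hq
        obtain ⟨h1, h2, h3⟩ := hmemJ q hq
        rw [hb q h1 h2 h3, hb' q h1 h2 h3]
        refine hoff _ fun q' hq' he' => ?_
        rw [← mul_smul] at he'
        exact hJd q' hq' q hq (hfree.smul_left_inj he').symm)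
  refine ⟨B, hB, fun u hu => ?_⟩
  have := hBU u hu
  push Not at this
  obtain ⟨q, h1, h2, h3, h4⟩ := this
  refine ⟨q, h1, h2, h3, ?_⟩
  tauto

end

/-! ### Breaking periods -/

section

variable {G : Type u} [Group G] {X : Type v} [MeasurableSpace X] [MulAction G X]

theorem exists_sparse_syndetic_subset [StandardBorelSpace X] [MeasurableConstSMul G X]
    (hfree : IsFreeAction G X) {W : Finset G} {R : Set X} (hR : MeasurableSet R)
    (hW : IsSyndetic W R) (S : Finset G) (h1 : 1 ∈ S) (hinv : ∀ s ∈ S, s⁻¹ ∈ S) :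
    ∃ R' ⊆ R, MeasurableSet R' ∧ IsSyndetic (S * W) R' ∧
      ∀ y ∈ R', ∀ g ∈ S, g • y ∈ R' → g = 1 := by
  obtain ⟨R', hsub, hm, hind, hmax⟩ := exists_maximal_independent hfree (S.erase 1)
    (Finset.notMem_erase _ _) (fun s hs => by
      rw [Finset.mem_erase] at hs ⊢
      exact ⟨inv_ne_one.mpr hs.1, hinv s hs.2⟩) hR
  refine ⟨R', hsub, hm, fun x => ?_, fun y hy g hg h => ?_⟩
  · obtain ⟨w, hw, hx⟩ := hW x
    rcases hmax _ hx with h | ⟨s, hs, h⟩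
    · exact ⟨1 * w, Finset.mul_mem_mul h1 hw, by rwa [one_mul]⟩
    · exact ⟨s * w, Finset.mul_mem_mul (Finset.mem_of_mem_erase hs) hw, by rwa [mul_smul]⟩
  · by_contra hne
    exact hind y hy g (Finset.mem_erase.mpr ⟨hne, hg⟩) h

/-- Markers are treated color by color. A difference found between `q • y` and `q • u • y` can be
spoiled only if a later marker rewrites the second point. That marker is `g • u • y` for some `g` in
`Q * Q`, and its own constraint for `g * u⁻¹ * g⁻¹` compares its window with points near `y`, which
no still later marker touches. This is why conjugates of `U` are included. -/
theorem exists_aperiodic_modification [Countable G] [StandardBorelSpace X]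
    [MeasurableConstSMul G X] (hfree : IsFreeAction G X) {A R R' : Set X} (hA : MeasurableSet A)
    (hR : MeasurableSet R) (hR' : MeasurableSet R') (Q : Finset G) (h1 : 1 ∈ Q)
    (hinv : ∀ q ∈ Q, q⁻¹ ∈ Q)
    (hsparse : ∀ y ∈ R', ∀ g ∈ Q * Q * (Q * Q), g • y ∈ R' → g = 1)
    (U : Finset G) (hU1 : 1 ∉ U) (hUinv : ∀ u ∈ U, u⁻¹ ∈ U) (M : ℕ)
    (hcard : (Finset.image₂ (fun g u => g * u * g⁻¹) (Q * Q) U).card < 2 ^ M)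
    (hM : ∀ y ∈ R', 3 * M + 1 ≤ (Q.filter fun q => q • y ∈ R \ R').card) :
    ∃ A' : Set X, MeasurableSet A' ∧ (∀ x ∉ R, (x ∈ A' ↔ x ∈ A)) ∧
      ∀ B : Set X, (∀ x ∉ R', (x ∈ B ↔ x ∈ A')) → ∀ y ∈ R', ∀ u ∈ U,
        ∃ g ∈ Q * Q * Q, ¬(g • y ∈ B ↔ g • u • y ∈ B) := by
  set V := R \ R' with hVdef
  have hV : MeasurableSet V := hR.diff hR'
  obtain ⟨U', hU'⟩ : ∃ U', U' = Finset.image₂ (fun g u => g * u * g⁻¹) (Q * Q) U := ⟨_, rfl⟩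
  rw [← hU'] at hcard
  have hconj : ∀ g ∈ Q * Q, ∀ u ∈ U, g * u * g⁻¹ ∈ U' := fun g hg u hu =>
    hU' ▸ Finset.mem_image₂_of_mem hg hu
  have h11 : (1 : G) ∈ Q * Q := by simpa using Finset.mul_mem_mul h1 h1
  have hUU' : U ⊆ U' := fun u hu => by simpa using hconj 1 h11 u hu
  have hU'1 : 1 ∉ U' := by
    intro h
    rw [hU', Finset.mem_image₂] at h
    obtain ⟨g, -, u, hu, h⟩ := h
    rw [mul_inv_eq_one, mul_eq_left] at h
    exact hU1 (h ▸ hu)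
  have hQQ : ∀ y ∈ R', ∀ y' ∈ R', ∀ q ∈ Q, ∀ q' ∈ Q, q • y = q' • y' → q = q' ∧ y = y' := by
    intro y hy y' hy' q hq q' hq' h
    have h2 : (q'⁻¹ * q) • y = y' := by rw [mul_smul, h, inv_smul_smul]
    have h3 := hsparse y hy (q'⁻¹ * q) (by
      simpa using Finset.mul_mem_mul (Finset.mul_mem_mul (hinv q' hq') hq) h11) (h2 ▸ hy')
    rw [h3, one_smul] at h2
    rw [inv_mul_eq_one] at h3
    exact ⟨h3.symm, h2⟩
  -- The constraint at `y` reads exactly the positions in `F` and writes only in `Q`. The coloring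
  -- keeps markers of equal color from writing where another reads.
  set F := Q ∪ Q * U' with hF
  obtain ⟨c, hc, hcS⟩ := exists_coloring hfree ((Q * F).erase 1) (Finset.notMem_erase _ _)
  let D : ℕ → Set X := fun k => {y | y ∈ R' ∧ c y = k}
  have hD : ∀ k, MeasurableSet (D k) := fun k => hR'.inter (hc (measurableSet_singleton k))
  have stage : ∀ (A : {A : Set X // MeasurableSet A}) (k : ℕ),
      ∃ A' : {A : Set X // MeasurableSet A},
      (∀ x, (x ∉ V ∨ ∀ y ∈ D k, ∀ q ∈ Q, x ≠ q • y) → (x ∈ A'.1 ↔ x ∈ A.1)) ∧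
      ∀ y ∈ D k, ∀ u ∈ U', ∃ q ∈ Q, q • y ∈ V ∧ q • u • y ∉ R' ∧
        ¬(q • y ∈ A'.1 ↔ q • u • y ∈ A'.1) := by
    rintro ⟨A, hA⟩ k
    have htr : ∀ (B : Set X) (y : X), ∀ u ∈ U', ∀ q ∈ Q, (q ∈ trace F B y ↔ q • y ∈ B) ∧
        (q * u ∈ trace F B y ↔ q • u • y ∈ B) := by
      intro B y u hu q hq
      have h2 : q ∈ F := Finset.mem_union_left _ hq
      have h3 : q * u ∈ F := Finset.mem_union_right _ (Finset.mul_mem_mul hq hu)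
      simp [trace, h2, h3, mul_smul]
    obtain ⟨A', hA', hoff, hΦ⟩ := exists_local_modification hfree hA hV (hD k) (F := F) (Q := Q)
      (by
        rintro y ⟨hy, hyk⟩ y' ⟨hy', hyk'⟩ g hg q hq h
        by_contra hne
        have h2 : (q⁻¹ * g) • y = y' := by rw [mul_smul, h, inv_smul_smul]
        refine hcS y (q⁻¹ * g) (Finset.mem_erase.mpr ⟨?_, Finset.mul_mem_mul (hinv q hq) hg⟩) ?_
        · intro h3
          rw [h3, one_smul] at h2
          exact hne h2
        · rw [h2, hyk, hyk'])
      (fun y π => ∀ u ∈ U', ∃ q ∈ Q, q • y ∈ V ∧ q • u • y ∉ R' ∧ ¬(q ∈ π ↔ q * u ∈ π))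
      (by
        intro π
        have : {y : X | ∀ u ∈ U', ∃ q ∈ Q, q • y ∈ V ∧ q • u • y ∉ R' ∧ ¬(q ∈ π ↔ q * u ∈ π)} =
            ⋂ u ∈ U', ⋃ q ∈ Q, {y | q • y ∈ V} ∩ ({y | (q * u) • y ∈ R'}ᶜ ∩
              {_y | ¬(q ∈ π ↔ q * u ∈ π)}) := by
          ext y
          simp only [Set.mem_ofPred_eq, Set.mem_iInter, Set.mem_iUnion, Set.mem_inter_iff,
            Set.mem_compl_iff, mul_smul, exists_prop]
        rw [this]
        exact Finset.measurableSet_biInter _ fun u _ => Finset.measurableSet_biUnion _ fun q _ =>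
          (measurableSet_smul_mem hV _).inter ((measurableSet_smul_mem hR' _).compl.inter
            (MeasurableSet.const _)))
      (by
        rintro y ⟨hy, -⟩
        obtain ⟨B, hB, hBU⟩ := exists_separating_modification hfree A V R' y Q U' M
          (by convert hM y hy)
          (by
            intro u _ q hq q' hq' h2 h3
            have h4 : (q'⁻¹ * q) = 1 := by
              have := hsparse _ h3 (q * q'⁻¹) (by
                simpa using Finset.mul_mem_mul (Finset.mul_mem_mul hq (hinv q' hq')) h11)
                (by rwa [mul_smul, inv_smul_smul])
              rw [mul_inv_eq_one] at this
              rw [this, inv_mul_cancel]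
            exact (inv_mul_eq_one.mp h4).symm) hU'1 hcard
        refine ⟨B, hB, fun u hu => ?_⟩
        obtain ⟨q, hq, h2, h3, h4⟩ := hBU u hu
        refine ⟨q, hq, h2, h3, ?_⟩
        rwa [(htr B y u hu q hq).1, (htr B y u hu q hq).2])
    refine ⟨⟨A', hA'⟩, hoff, fun y hy u hu => ?_⟩
    obtain ⟨q, hq, h2, h3, h4⟩ := hΦ y hy u hu
    refine ⟨q, hq, h2, h3, ?_⟩
    rwa [(htr A' y u hu q hq).1, (htr A' y u hu q hq).2] at h4
  choose next hoff hsepn using stage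
  let a : ℕ → {A : Set X // MeasurableSet A} := fun n => Nat.rec ⟨A, hA⟩ (fun k A => next A k) n
  have ha : ∀ k, a (k + 1) = next (a k) k := fun k => rfl
  -- The points that stage `k` or a later one may still change.
  let Un : ℕ → Set X := fun k => {x | x ∈ V ∧ ∃ q ∈ Q, q⁻¹ • x ∈ R' ∧ k ≤ c (q⁻¹ • x)}
  have hUn : ∀ k, MeasurableSet (Un k) := by
    intro k
    have : {x : X | ∃ q ∈ Q, q⁻¹ • x ∈ R' ∧ k ≤ c (q⁻¹ • x)} =
        ⋃ q ∈ Q, {x | q⁻¹ • x ∈ R' ∩ c ⁻¹' (Set.Ici k)} := by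
      ext x; simp [and_left_comm]
    refine hV.inter ((congrArg MeasurableSet this).mpr ?_)
    exact Finset.measurableSet_biUnion _ fun q _ =>
      measurableSet_smul_mem (hR'.inter (hc measurableSet_Ici)) _
  obtain ⟨A', hA', hlim⟩ := exists_limit (A := fun k => (a k).1) (U := Un) (fun k => (a k).2) hUn
    (by
      rintro k x ⟨hx, q, hq, h2, h3⟩
      exact ⟨hx, q, hq, h2, by omega⟩)
    (by
      intro k x hx
      refine hoff (a k) k x ?_
      by_cases hxV : x ∈ V
      · right
        rintro y ⟨hy, hyk⟩ q hq rfl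
        exact hx ⟨hxV, q, hq, by rwa [inv_smul_smul], by rw [inv_smul_smul, hyk]⟩
      · exact Or.inl hxV)
  refine ⟨A', hA', fun x hx => hlim 0 x fun h => hx h.1.1, fun B hB => ?_⟩
  have main : ∀ y ∈ R', ∀ u ∈ U', (∀ q ∈ Q, q • u • y ∉ Un (c y + 1)) →
      ∃ q ∈ Q, ¬(q • y ∈ B ↔ q • u • y ∈ B) := by
    intro y hy u hu hnot
    obtain ⟨q, hq, h2, h3, h4⟩ := hsepn (a (c y)) (c y) y ⟨hy, rfl⟩ u hu
    rw [← ha] at h4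
    refine ⟨q, hq, ?_⟩
    rw [hB _ h2.2, hB _ h3, hlim (c y + 1) _ (hnot q hq), hlim (c y + 1) (q • y) ?_]
    · exact h4
    · rintro ⟨-, q', hq', h5, h6⟩
      have h7 := (hQQ y hy _ h5 q hq q' hq' (by rw [smul_inv_smul])).2
      rw [← h7] at h6
      omega
  intro y hy u hu
  by_cases hcase : ∀ q ∈ Q, q • u • y ∉ Un (c y + 1)
  · obtain ⟨q, hq, h⟩ := main y hy u (hUU' hu) hcase
    exact ⟨q, by simpa using Finset.mul_mem_mul h11 hq, h⟩
  -- Some `q0 • u • y` lies in the window of a later marker; the argument is carried out from that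
  -- marker.
  · push Not at hcase
    obtain ⟨q0, hq0, -, q1, hq1, hy', hlt⟩ := hcase
    obtain ⟨g, hg⟩ : ∃ g, g = q1⁻¹ * q0 := ⟨_, rfl⟩
    have hgQ : g ∈ Q * Q := hg ▸ Finset.mul_mem_mul (hinv _ hq1) hq0
    rw [← mul_smul q1⁻¹, ← hg] at hy' hlt
    have hback : ∀ q : G, q • (g * u⁻¹ * g⁻¹) • g • u • y = q • g • y := by
      intro q
      simp [← mul_smul]
    obtain ⟨q, hq, h⟩ := main (g • u • y) hy' (g * u⁻¹ * g⁻¹) (hconj g hgQ _ (hUinv u hu)) (by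
      intro q hq
      rw [hback]
      rintro ⟨-, q3, hq3, h5, h6⟩
      have h7 : q3⁻¹ • q • g • y = (q3⁻¹ * q * g) • y := by simp [mul_smul]
      rw [h7] at h5 h6
      have h8 := hsparse y hy _ (Finset.mul_mem_mul (Finset.mul_mem_mul (hinv _ hq3) hq) hgQ) h5
      rw [h8, one_smul] at h6
      omega)
    rw [hback] at h
    refine ⟨q * g, ?_, ?_⟩
    · rw [mul_assoc]
      exact Finset.mul_mem_mul hq hgQ
    · rw [mul_smul, mul_smul]
      tauto

end

/-! ### Codes and one stage of the construction -/

section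

variable {G : Type u} [Group G]

/-- The `0`-`1` sequence recording the visits of the orbit of `x` to `B`. -/
noncomputable def code {X : Type v} [MulAction G X] (B : Set X) (x : X) : G → Bool :=
  fun g => decide (g⁻¹ • x ∈ B)

theorem code_inv {X : Type v} [MulAction G X] (B : Set X) (x : X) (g : G) :
    code B x g⁻¹ = true ↔ g • x ∈ B := by
  simp [code]

theorem code_smul {X : Type v} [MulAction G X] (B : Set X) (x : X) (g : G) :
    code B (g • x) = shift g (code B x) := by
  funext h
  simp [code, shift, mul_smul]

/-- Given any set and any `W`-syndetic set `R` of still undecided points, deciding all points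
of `R` outside some `W'`-syndetic set suffices to put all codes into `C`. -/
def Forces (W W' : Finset G) (C : Set (G → Bool)) : Prop :=
  ∀ (X : Type v) [MeasurableSpace X] [StandardBorelSpace X] [MulAction G X]
    [MeasurableConstSMul G X], IsFreeAction G X →
    ∀ A R : Set X, MeasurableSet A → MeasurableSet R → IsSyndetic W R →
    ∃ A' R' : Set X, MeasurableSet A' ∧ MeasurableSet R' ∧ R' ⊆ R ∧ IsSyndetic W' R' ∧
      (∀ x ∉ R, (x ∈ A' ↔ x ∈ A)) ∧
      ∀ B : Set X, (∀ x ∉ R', (x ∈ B ↔ x ∈ A')) → ∀ x, code B x ∈ C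

/-- The second stage works inside the points left undecided by the first, whose guarantee covers
every such change. -/
theorem Forces.inter {W W₁ W₂ : Finset G} {C D : Set (G → Bool)} (hC : Forces.{u, v} W W₁ C)
    (hD : Forces.{u, v} W₁ W₂ D) : Forces.{u, v} W W₂ (C ∩ D) := by
  intro X _ _ _ _ hfree A R hA hR hW
  obtain ⟨A₁, R₁, hA₁, hR₁, hsub₁, hW₁, hoff₁, h₁⟩ := hC X hfree A R hA hR hW
  obtain ⟨A₂, R₂, hA₂, hR₂, hsub₂, hW₂, hoff₂, h₂⟩ := hD X hfree A₁ R₁ hA₁ hR₁ hW₁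
  refine ⟨A₂, R₂, hA₂, hR₂, hsub₂.trans hsub₁, hW₂, fun x hx => ?_, fun B hB x => ⟨?_, ?_⟩⟩
  · rw [hoff₂ x fun h => hx (hsub₁ h), hoff₁ x hx]
  · exact h₁ B (fun x hx => by rw [hB x fun h => hx (hsub₂ h), hoff₂ x hx]) x
  · exact h₂ B hB x

theorem Forces.mono {W W₁ W₂ : Finset G} {C : Set (G → Bool)} (hC : Forces.{u, v} W W₁ C)
    (h : W₁ ⊆ W₂) : Forces.{u, v} W W₂ C := by
  intro X _ _ _ _ hfree A R hA hR hW
  obtain ⟨A₁, R₁, hA₁, hR₁, hsub₁, hW₁, h₁⟩ := hC X hfree A R hA hR hW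
  refine ⟨A₁, R₁, hA₁, hR₁, hsub₁, fun x => ?_, h₁⟩
  obtain ⟨w, hw, hx⟩ := hW₁ x
  exact ⟨w, h hw, hx⟩

/-- In a `W`-syndetic set each of the disjoint blocks `W * c i` carries an undecided point, so a
window of size linear in `m` offers `m` free bits. -/
theorem exists_symmetric_window [Infinite G] (W : Finset G) (m : ℕ) :
    ∃ (c : ℕ → G) (Q : Finset G), 1 ∈ Q ∧ (∀ q ∈ Q, q⁻¹ ∈ Q) ∧
      Q.card ≤ 2 * (m * W.card) + 1 ∧ (∀ i < m, ∀ w ∈ W, w * c i ∈ Q) ∧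
      (∀ i, ∀ w ∈ W, w * c i ≠ 1) ∧
      ∀ i j, ∀ w ∈ W, ∀ w' ∈ W, w * c i = w' * c j → i = j := by
  obtain ⟨c, hc1, hc2⟩ := exists_disjoint_translates W
  obtain ⟨P, hP⟩ : ∃ P, P = (Finset.range m).biUnion fun i => W.image (· * c i) := ⟨_, rfl⟩
  have hPc : P.card ≤ m * W.card := by
    rw [hP]
    refine (Finset.card_biUnion_le_card_mul _ _ W.card fun i _ => Finset.card_image_le).trans ?_
    rw [Finset.card_range]
  refine ⟨c, insert 1 (P ∪ P⁻¹), Finset.mem_insert_self _ _, fun q hq => ?_, ?_, ?_, hc1, hc2⟩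
  · simp only [Finset.mem_insert, Finset.mem_union, Finset.mem_inv', inv_eq_one, inv_inv] at hq ⊢
    tauto
  · refine (Finset.card_insert_le _ _).trans ?_
    have h1 := Finset.card_union_le P P⁻¹
    rw [Finset.card_inv] at h1
    omega
  · intro i hi w hw
    refine Finset.mem_insert_of_mem (Finset.mem_union_left _ ?_)
    rw [hP]
    exact Finset.mem_biUnion.mpr ⟨i, Finset.mem_range.mpr hi, Finset.mem_image_of_mem _ hw⟩

theorem exists_forces_aperiodic [Countable G] [Infinite G] (W : Finset G) {s : G} (hs : s ≠ 1) :
    ∃ (W' : Finset G) (C : Set (G → Bool)), IsClosed C ∧ (∀ w ∈ C, shift s w ≠ w) ∧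
      Forces.{u, v} W W' C := by
  -- The events number at most `2 * Q.card ^ 6 * W.card`: four factors of `Q` and the `W` come from
  -- `T`, two more from conjugation, and the 2 from inverses.
  obtain ⟨M, hM⟩ := exists_mul_pow_lt_two_pow (2 * (6 * (W.card + 1)) ^ 6 * W.card) 6
  obtain ⟨c, Q, h1, hinv, hcard, hcQ, hc1, hcinj⟩ := exists_symmetric_window W (3 * M + 1)
  obtain ⟨T, hT⟩ : ∃ T, T = Q * Q * (Q * Q) * W := ⟨_, rfl⟩
  -- Moving from `x` to a marker `t • x` turns the period `s` into its conjugate by `t`.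
  obtain ⟨P, hP⟩ : ∃ P, P = T.image fun t => t * s * t⁻¹ := ⟨_, rfl⟩
  have hQ : Q.card ≤ 6 * (W.card + 1) * (M + 1) := hcard.trans (by nlinarith)
  have hTc : T.card ≤ Q.card ^ 4 * W.card := by
    rw [hT]
    refine Finset.card_mul_le.trans (Nat.mul_le_mul_right _ ?_)
    refine Finset.card_mul_le.trans ?_
    calc _ ≤ (Q.card * Q.card) * (Q.card * Q.card) :=
          Nat.mul_le_mul Finset.card_mul_le Finset.card_mul_le
      _ = _ := by ring
  have hPc : P.card ≤ T.card := hP ▸ Finset.card_image_le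
  have hU : (Finset.image₂ (fun g u => g * u * g⁻¹) (Q * Q) (P ∪ P⁻¹)).card < 2 ^ M := by
    refine lt_of_le_of_lt ?_ hM
    have h2 : (P ∪ P⁻¹).card ≤ 2 * (Q.card ^ 4 * W.card) := by
      have h1 := Finset.card_union_le P P⁻¹
      rw [Finset.card_inv] at h1
      omega
    calc _ ≤ (Q * Q).card * (P ∪ P⁻¹).card := Finset.card_image₂_le _ _ _
      _ ≤ (Q.card * Q.card) * (2 * (Q.card ^ 4 * W.card)) :=
          Nat.mul_le_mul Finset.card_mul_le h2
      _ = 2 * Q.card ^ 6 * W.card := by ring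
      _ ≤ 2 * (6 * (W.card + 1) * (M + 1)) ^ 6 * W.card := by gcongr
      _ = _ := by ring
  have hP1 : 1 ∉ P ∪ P⁻¹ := by
    have : 1 ∉ P := by
      rw [hP, Finset.mem_image]
      rintro ⟨t, -, h⟩
      rw [mul_inv_eq_one, mul_eq_left] at h
      exact hs h
    simpa using this
  refine ⟨T, ⋃ k ∈ Q * Q * Q * T, {w | w k⁻¹ ≠ w (s⁻¹ * k⁻¹)}, ?_, ?_, ?_⟩
  · refine isClosed_biUnion_finset fun k _ => ?_
    have : IsClopen {p : Bool × Bool | p.1 ≠ p.2} := isClopen_discrete _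
    exact this.isClosed.preimage
      (f := fun w : G → Bool => (w k⁻¹, w (s⁻¹ * k⁻¹))) (by fun_prop)
  · intro w hw h
    obtain ⟨k, -, hk⟩ := Set.mem_iUnion₂.mp hw
    exact hk (congrFun h k⁻¹).symm
  · intro X _ _ _ _ hfree A R hA hR hW
    have h11 : (1 : G) ∈ Q * Q := by simpa using Finset.mul_mem_mul h1 h1
    have hQ2 : ∀ q ∈ Q, q ∈ Q * Q * (Q * Q) := fun q hq => by
      simpa using Finset.mul_mem_mul (Finset.mul_mem_mul hq h1) h11
    obtain ⟨R', hsub, hR', hsyn, hsparse⟩ := exists_sparse_syndetic_subset hfree hR hW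
      (Q * Q * (Q * Q)) (hQ2 1 h1) (by
        intro g hg
        obtain ⟨a, ha, b, hb, rfl⟩ := Finset.mem_mul.mp hg
        obtain ⟨a1, ha1, a2, ha2, rfl⟩ := Finset.mem_mul.mp ha
        obtain ⟨b1, hb1, b2, hb2, rfl⟩ := Finset.mem_mul.mp hb
        rw [mul_inv_rev, mul_inv_rev, mul_inv_rev]
        exact Finset.mul_mem_mul (Finset.mul_mem_mul (hinv _ hb2) (hinv _ hb1))
          (Finset.mul_mem_mul (hinv _ ha2) (hinv _ ha1)))
    obtain ⟨A', hA', hoff, hB⟩ := exists_aperiodic_modification hfree hA hR hR' Q h1 hinv hsparse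
      (P ∪ P⁻¹) hP1 (by
        intro u hu
        simp only [Finset.mem_union, Finset.mem_inv', inv_inv] at hu ⊢
        tauto) M hU (by
        intro y hy
        -- One undecided point per block gives `3 * M + 1` distinct ones. They avoid `R'` because
        -- markers are sparse and `w * c i ≠ 1`.
        have hw : ∀ i, ∃ w ∈ W, (w * c i) • y ∈ R := fun i => by
          obtain ⟨w, hw, h⟩ := hW (c i • y)
          exact ⟨w, hw, by rwa [mul_smul]⟩
        choose w hw hwR using hw
        rw [← Finset.card_range (3 * M + 1)]
        refine Finset.card_le_card_of_injOn (fun i => w i * c i) ?_ ?_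
        · intro i hi
          have hiQ := hcQ i (Finset.mem_range.mp hi) _ (hw i)
          simp only [Finset.coe_filter, Set.mem_ofPred_eq]
          exact ⟨hiQ, hwR i, fun h => hc1 i _ (hw i) (hsparse y hy _ (hQ2 _ hiQ) h)⟩
        · intro i _ j _ h
          exact hcinj i j _ (hw i) _ (hw j) h)
    refine ⟨A', R', hA', hR', hsub, hT ▸ hsyn, hoff, fun B hBA x => ?_⟩
    rw [← hT] at hsyn
    obtain ⟨t, ht, hx⟩ := hsyn x
    obtain ⟨g, hg, hne⟩ := hB B hBA (t • x) hx (t * s * t⁻¹)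
      (Finset.mem_union_left _ (hP ▸ Finset.mem_image_of_mem _ ht))
    refine Set.mem_iUnion₂.mpr ⟨g * t, Finset.mul_mem_mul hg ht, fun h => hne ?_⟩
    have h2 : s⁻¹ * (g * t)⁻¹ = (g * (t * s))⁻¹ := by group
    rw [h2, Bool.eq_iff_iff, code_inv, code_inv] at h
    simpa [← mul_smul, mul_assoc] using h

end

/-! ### Writing a bit through parities -/

theorem even_card_filter_congr {α : Type*} {W : Finset α} {a : α} (ha : a ∈ W) {P P' : α → Prop}
    (h : ∀ b ∈ W, b ≠ a → (P b ↔ P' b)) (hP : Even (W.filter P).card)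
    (hP' : Even (W.filter P').card) : P a ↔ P' a := by
  have h1 : ∀ R : α → Prop, (W.filter R).card =
      ((W.erase a).filter R).card + if R a then 1 else 0 := by
    intro R
    conv_lhs => rw [← Finset.insert_erase ha, Finset.filter_insert]
    split_ifs
    · rw [Finset.card_insert_of_notMem (by simp)]
    · rfl
  have h2 : (W.erase a).filter P = (W.erase a).filter P' :=
    Finset.filter_congr fun b hb => h b (Finset.mem_of_mem_erase hb) (Finset.ne_of_mem_erase hb)
  rw [h1, h2] at hP
  rw [h1] at hP'
  by_cases hp : P a <;> by_cases hp' : P' a <;> simp only [hp, hp', if_true, if_false] at hP hP' ⊢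
  · simp only [Nat.even_add_one] at hP; exact (hP (by simpa using hP')).elim
  · simp only [Nat.even_add_one] at hP'; exact (hP' (by simpa using hP)).elim

theorem isClosed_setOf_finite_dependence {α : Type*} (F : Finset α) (P : (α → Bool) → Prop)
    (h : ∀ w w', (∀ g ∈ F, w g = w' g) → (P w ↔ P w')) : IsClosed {w | P w} := by
  rw [← isOpen_compl_iff, isOpen_iff_mem_nhds]
  intro w hw
  have h1 : {w' : α → Bool | ∀ g ∈ F, w' g = w g} ∈ nhds w := by
    have : IsOpen {w' : α → Bool | ∀ g ∈ F, w' g = w g} := by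
      have h2 : {w' : α → Bool | ∀ g ∈ F, w' g = w g} = ⋂ g ∈ F, {w' | w' g = w g} := by
        ext; simp
      rw [h2]
      exact isOpen_biInter_finset fun g _ =>
        (isOpen_discrete ({w g} : Set Bool)).preimage (f := fun w' : α → Bool => w' g)
          (continuous_apply g)
    exact this.mem_nhds fun _ _ => rfl
  exact Filter.mem_of_superset h1 fun w' hw' hP => hw ((h w w' fun g hg => (hw' g hg).symm).mpr hP)

section

variable {G : Type u} [Group G]

section

variable {X : Type v} [MeasurableSpace X] [MulAction G X]

/-- In each block `W * c i` one undecided point is reset to correct the parity; the blocks are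
disjoint, so the corrections do not interact. -/
theorem exists_even_modification [Countable G] [MeasurableConstSMul G X]
    (hfree : IsFreeAction G X) {A R R' : Set X} (hA : MeasurableSet A) (hR : MeasurableSet R)
    (hR' : MeasurableSet R') {W : Finset G} (hW : IsSyndetic W R) {c : ℕ → G} {Q : Finset G}
    {r : ℕ} (hinv : ∀ q ∈ Q, q⁻¹ ∈ Q) (hcQ : ∀ i < r, ∀ w ∈ W, w * c i ∈ Q)
    (hcinj : ∀ i j, ∀ w ∈ W, ∀ w' ∈ W, w * c i = w' * c j → i = j)
    (hsparse : ∀ y ∈ R', ∀ g ∈ Q * Q, g • y ∈ R' → g = 1)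
    (hdisj : ∀ y ∈ R', ∀ i < r, ∀ w ∈ W, (w * c i) • y ∉ R') :
    ∃ A' : Set X, MeasurableSet A' ∧ (∀ x ∉ R, (x ∈ A' ↔ x ∈ A)) ∧
      ∀ B : Set X, (∀ x ∉ R', (x ∈ B ↔ x ∈ A')) → ∀ y ∈ R', ∀ i < r,
        Even (W.filter fun w => (w * c i) • y ∈ B).card := by
  have htr : ∀ (B : Set X) (y : X), ∀ i < r, (W.filter fun w => w * c i ∈ trace Q B y) =
      W.filter fun w => (w * c i) • y ∈ B := by
    intro B y i hi
    refine Finset.filter_congr fun w hw => ?_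
    simp [trace, hcQ i hi w hw]
  obtain ⟨A', hA', hoff, hΦ⟩ := exists_local_modification hfree hA (hR.diff hR') hR'
    (F := Q) (Q := Q) (by
      intro y hy y' hy' g hg q hq h
      have h2 : (q⁻¹ * g) • y = y' := by rw [mul_smul, h, inv_smul_smul]
      have h3 := hsparse y hy _ (Finset.mul_mem_mul (hinv q hq) hg) (h2 ▸ hy')
      rwa [h3, one_smul] at h2)
    (fun _ π => ∀ i < r, Even (W.filter fun w => w * c i ∈ π).card)
    (fun π => MeasurableSet.const _) (by
      intro y hy
      have hw : ∀ i, ∃ w ∈ W, (w * c i) • y ∈ R := fun i => by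
        obtain ⟨w, hw, h⟩ := hW (c i • y)
        exact ⟨w, hw, by rwa [mul_smul]⟩
      choose w hw hwR using hw
      -- The parity of the rest of the block is the value the reset point must take.
      let odd : ℕ → Prop := fun i => Odd ((W.erase (w i)).filter fun w => (w * c i) • y ∈ A).card
      obtain ⟨B, hB⟩ : ∃ B : Set X, B = {x | (∃ i < r, x = (w i * c i) • y ∧ odd i) ∨
        ((∀ i < r, x ≠ (w i * c i) • y) ∧ x ∈ A)} := ⟨_, rfl⟩
      have hmem : ∀ i < r, ∀ b ∈ W, ((b * c i) • y ∈ B ↔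
          (b = w i ∧ odd i) ∨ (b ≠ w i ∧ (b * c i) • y ∈ A)) := by
        intro i hi b hb
        have h1 : ∀ j, (b * c i) • y = (w j * c j) • y → i = j ∧ b = w i := by
          intro j h
          have h2 := hfree.smul_left_inj h
          obtain rfl := hcinj i j b hb _ (hw j) h2
          exact ⟨rfl, mul_right_cancel h2⟩
        rw [hB]
        constructor
        · rintro (⟨j, hj, h2, h3⟩ | ⟨h2, h3⟩)
          · obtain ⟨rfl, h4⟩ := h1 j h2
            exact Or.inl ⟨h4, h3⟩
          · exact Or.inr ⟨fun h => h2 i hi (by rw [h]), h3⟩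
        · rintro (⟨h2, h3⟩ | ⟨h2, h3⟩)
          · exact Or.inl ⟨i, hi, by rw [h2], h3⟩
          · exact Or.inr ⟨fun j hj h => h2 (h1 j h).2, h3⟩
      refine ⟨B, fun x hx => ?_, fun i hi => ?_⟩
      · have hne : ∀ i < r, x ≠ (w i * c i) • y := by
          intro i hi h
          rcases hx with hx | hx
          · exact hx (h ▸ ⟨hwR i, hdisj y hy i hi _ (hw i)⟩)
          · exact hx _ (hcQ i hi _ (hw i)) h
        rw [hB]
        constructor
        · rintro (⟨i, hi, h, -⟩ | ⟨-, h⟩)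
          · exact (hne i hi h).elim
          · exact h
        · exact fun h => Or.inr ⟨hne, h⟩
      · rw [htr B y i hi]
        have h1 : (W.filter fun b => (b * c i) • y ∈ B) =
            (insert (w i) (W.erase (w i))).filter fun b =>
              (b = w i ∧ odd i) ∨ (b ≠ w i ∧ (b * c i) • y ∈ A) := by
          rw [Finset.insert_erase (hw i)]
          exact Finset.filter_congr fun b hb => hmem i hi b hb
        have h2 : ((W.erase (w i)).filter fun b =>
            (b = w i ∧ odd i) ∨ (b ≠ w i ∧ (b * c i) • y ∈ A)) =
            (W.erase (w i)).filter fun b => (b * c i) • y ∈ A :=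
          Finset.filter_congr fun b hb => by simp [Finset.ne_of_mem_erase hb]
        rw [h1, Finset.filter_insert, h2]
        by_cases ho : odd i
        · rw [if_pos (Or.inl ⟨rfl, ho⟩), Finset.card_insert_of_notMem (by simp)]
          exact Odd.add_one ho
        · rw [if_neg (by simp [ho])]
          exact Nat.not_odd_iff_even.mp ho)
  refine ⟨A', hA', fun x hx => hoff x (Or.inl fun h => hx h.1), fun B hB y hy i hi => ?_⟩
  have h1 := hΦ y hy i hi
  rw [htr A' y i hi] at h1
  rw [Finset.filter_congr fun w hw => hB _ (hdisj y hy i hi w hw)]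
  exact h1

/-- If all parities at `t` were even, one undecided point per block would be determined by the other
points. At most one block contains the marker itself, which must stay undecided; so of `M + 1`
blocks `M` are usable, and `T.card < 2 ^ M` allows the union bound. -/
theorem exists_odd_modification [Countable G] [MeasurableConstSMul G X]
    (hfree : IsFreeAction G X) {A R R' : Set X} (hA : MeasurableSet A) (hR : MeasurableSet R)
    (hR' : MeasurableSet R') {W : Finset G} (hW : IsSyndetic W R) {c : ℕ → G} {N T : Finset G}
    {M : ℕ} (hinv : ∀ q ∈ N, q⁻¹ ∈ N) (h1 : 1 ∈ N)
    (hcN : ∀ i < M + 1, ∀ w ∈ W, ∀ t ∈ T, w * c i * t ∈ N)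
    (hcinj : ∀ i j, ∀ w ∈ W, ∀ w' ∈ W, w * c i = w' * c j → i = j)
    (hsparse : ∀ y ∈ R', ∀ g ∈ N * N, g • y ∈ R' → g = 1) (hT : T.card < 2 ^ M) :
    ∃ A' : Set X, MeasurableSet A' ∧ (∀ x ∉ R, (x ∈ A' ↔ x ∈ A)) ∧
      ∀ B : Set X, (∀ x ∉ R', (x ∈ B ↔ x ∈ A')) → ∀ y ∈ R', ∀ t ∈ T, ∃ i < M + 1,
        ¬ Even (W.filter fun w => (w * c i * t) • y ∈ B).card := by
  have htr : ∀ (B : Set X) (y : X), ∀ i < M + 1, ∀ t ∈ T,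
      (W.filter fun w => w * c i * t ∈ trace N B y) =
      W.filter fun w => (w * c i * t) • y ∈ B := by
    intro B y i hi t ht
    refine Finset.filter_congr fun w hw => ?_
    simp [trace, hcN i hi w hw t ht]
  have hnot : ∀ y ∈ R', ∀ g ∈ N, g ≠ 1 → g • y ∉ R' := fun y hy g hg hne h =>
    hne (hsparse y hy g (by simpa using Finset.mul_mem_mul hg h1) h)
  obtain ⟨A', hA', hoff, hΦ⟩ := exists_local_modification hfree hA (hR.diff hR') hR'
    (F := N) (Q := N) (by
      intro y hy y' hy' g hg q hq h
      have h2 : (q⁻¹ * g) • y = y' := by rw [mul_smul, h, inv_smul_smul]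
      have h3 := hsparse y hy _ (Finset.mul_mem_mul (hinv q hq) hg) (h2 ▸ hy')
      rwa [h3, one_smul] at h2)
    (fun _ π => ∀ t ∈ T, ∃ i < M + 1, (∀ w ∈ W, w * c i * t ≠ 1) ∧
      ¬ Even (W.filter fun w => w * c i * t ∈ π).card)
    (fun π => MeasurableSet.const _) (by
      intro y hy
      have hw : ∀ t i, ∃ w ∈ W, (w * c i * t) • y ∈ R := fun t i => by
        obtain ⟨w, hw, h⟩ := hW ((c i * t) • y)
        exact ⟨w, hw, by rwa [mul_assoc, mul_smul]⟩
      choose w hw hwR using hw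
      obtain ⟨B, hB, hBT⟩ := exists_modification_avoiding hfree A (R \ R') y N M T
        (fun t B => ∀ i < M + 1, (∀ w ∈ W, w * c i * t ≠ 1) →
          Even (W.filter fun w => (w * c i * t) • y ∈ B).card) hT (by
        intro t ht
        obtain ⟨I, hI⟩ : ∃ I, I = (Finset.range (M + 1)).filter fun i =>
          ∀ w ∈ W, w * c i * t ≠ 1 := ⟨_, rfl⟩
        have hmemI : ∀ i, i ∈ I ↔ i < M + 1 ∧ ∀ w ∈ W, w * c i * t ≠ 1 := by
          intro i; rw [hI]; simp
        have hIc : M ≤ I.card := by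
          have h2 : ((Finset.range (M + 1)).filter fun i =>
              ¬ ∀ w ∈ W, w * c i * t ≠ 1).card ≤ 1 := by
            refine Finset.card_le_one.mpr fun a ha b hb => ?_
            simp only [Finset.mem_filter, not_forall, not_not] at ha hb
            obtain ⟨-, wa, hwa, ha⟩ := ha
            obtain ⟨-, wb, hwb, hb⟩ := hb
            exact hcinj a b wa hwa wb hwb (mul_right_cancel (ha.trans hb.symm))
          have h3 := Finset.card_filter_add_card_filter_not (s := Finset.range (M + 1))
            (fun i => ∀ w ∈ W, w * c i * t ≠ 1)
          rw [Finset.card_range, ← hI] at h3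
          omega
        refine ⟨I.image fun i => w t i * c i * t, ?_, ?_, ?_, ?_⟩
        · intro q hq
          obtain ⟨i, hi, rfl⟩ := Finset.mem_image.mp hq
          exact hcN i ((hmemI i).mp hi).1 _ (hw t i) t ht
        · rw [Finset.card_image_of_injOn]
          · exact hIc
          · intro i _ j _ h
            exact hcinj i j _ (hw t i) _ (hw t j) (mul_right_cancel h)
        · intro q hq
          obtain ⟨i, hi, rfl⟩ := Finset.mem_image.mp hq
          obtain ⟨h2, h3⟩ := (hmemI i).mp hi
          exact ⟨hwR t i, hnot y hy _ (hcN i h2 _ (hw t i) t ht) (h3 _ (hw t i))⟩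
        · intro B B' hb hb' hBB q hq
          obtain ⟨i, hi, rfl⟩ := Finset.mem_image.mp hq
          obtain ⟨h2, h3⟩ := (hmemI i).mp hi
          refine even_card_filter_congr (P := fun w => (w * c i * t) • y ∈ B)
            (P' := fun w => (w * c i * t) • y ∈ B') (hw t i) (fun b hbW hne => ?_)
            (hb i h2 h3) (hb' i h2 h3)
          refine hBB _ fun q hq h => hne ?_
          obtain ⟨j, -, rfl⟩ := Finset.mem_image.mp hq
          have h4 := mul_right_cancel (hfree.smul_left_inj h)
          obtain rfl := hcinj i j b hbW _ (hw t j) h4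
          exact mul_right_cancel h4)
      refine ⟨B, hB, fun t ht => ?_⟩
      have h2 := hBT t ht
      push Not at h2
      obtain ⟨i, hi, h3, h4⟩ := h2
      refine ⟨i, hi, h3, ?_⟩
      rw [htr B y i hi t ht]
      exact h4)
  refine ⟨A', hA', fun x hx => hoff x (Or.inl fun h => hx h.1), fun B hB y hy t ht => ?_⟩
  obtain ⟨i, hi, h2, h3⟩ := hΦ y hy t ht
  refine ⟨i, hi, ?_⟩
  rw [htr A' y i hi t ht] at h3
  rw [Finset.filter_congr fun w hw => hB _ (hnot y hy _ (hcN i hi w hw t ht) (h2 w hw))]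
  exact h3

end

theorem exists_forces_bit [Countable G] [Infinite G] (W : Finset G) :
    ∃ (W' : Finset G) (C : Bool → Set (G → Bool)), (∀ b, IsClosed (C b)) ∧
      (∀ w, (∀ g, shift g w ∈ C false) → (∀ g, shift g w ∈ C true) → False) ∧
      ∀ b, Forces.{u, v} W W' (C b) := by
  obtain ⟨M, hM⟩ := exists_mul_pow_lt_two_pow ((3 * (W.card + 1)) ^ 2 * W.card) 2
  obtain ⟨c, Q, h1, hinv, hcard, hcQ, hc1, hcinj⟩ := exists_symmetric_window W (M + 1)
  -- `T` is the syndeticity window of the even markers, so refuting evenness throughout one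
  -- translate of `T` excludes the bit `true`.
  obtain ⟨T, hT⟩ : ∃ T, T = Q * Q * W := ⟨_, rfl⟩
  have hTc : T.card < 2 ^ M := by
    refine lt_of_le_of_lt ?_ hM
    have hQ : Q.card ≤ 3 * (W.card + 1) * (M + 1) := hcard.trans (by nlinarith)
    calc T.card ≤ Q.card * Q.card * W.card := by
          rw [hT]; exact Finset.card_mul_le.trans (Nat.mul_le_mul_right _ Finset.card_mul_le)
      _ = Q.card ^ 2 * W.card := by ring
      _ ≤ (3 * (W.card + 1) * (M + 1)) ^ 2 * W.card := by gcongr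
      _ = _ := by ring
  obtain ⟨N, hN⟩ : ∃ N, N = insert 1 (Q * T ∪ (Q * T)⁻¹) := ⟨_, rfl⟩
  have hN1 : 1 ∈ N := hN ▸ Finset.mem_insert_self _ _
  have hNinv : ∀ q ∈ N, q⁻¹ ∈ N := by
    intro q hq
    rw [hN] at hq ⊢
    simp only [Finset.mem_insert, Finset.mem_union, Finset.mem_inv', inv_eq_one, inv_inv] at hq ⊢
    tauto
  have hcN : ∀ i < M + 1, ∀ w ∈ W, ∀ t ∈ T, w * c i * t ∈ N := fun i hi w hw t ht =>
    hN ▸ Finset.mem_insert_of_mem (Finset.mem_union_left _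
      (Finset.mul_mem_mul (hcQ i hi w hw) ht))
  have hsymm : ∀ S : Finset G, (∀ q ∈ S, q⁻¹ ∈ S) → ∀ q ∈ S * S, q⁻¹ ∈ S * S := by
    intro S hS q hq
    obtain ⟨a, ha, b, hb, rfl⟩ := Finset.mem_mul.mp hq
    rw [mul_inv_rev]
    exact Finset.mul_mem_mul (hS b hb) (hS a ha)
  let θ : (G → Bool) → G → Prop := fun w t =>
    ∀ i < M + 1, Even (W.filter fun v => w (v * c i * t)⁻¹ = true).card
  have hθ : ∀ w w' : G → Bool, ∀ t, (∀ v ∈ W, ∀ i < M + 1, w (v * c i * t)⁻¹ = w' (v * c i * t)⁻¹) →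
      (θ w t ↔ θ w' t) := by
    intro w w' t h
    refine forall₂_congr fun i hi => ?_
    rw [Finset.filter_congr fun v hv => (by rw [h v hv i hi] :
      w (v * c i * t)⁻¹ = true ↔ w' (v * c i * t)⁻¹ = true)]
  have hθcode : ∀ {X : Type v} [MulAction G X] (B : Set X) (x : X) (t : G),
      θ (code B x) t ↔ ∀ i < M + 1, Even (W.filter fun v => (v * c i * t) • x ∈ B).card := by
    intro X _ B x t
    refine forall₂_congr fun i hi => ?_
    rw [Finset.filter_congr fun v hv => code_inv B x (v * c i * t)]
  -- Under `true`, every translate of `T` along the orbit contains a place with all parities even.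
  -- Under `false`, some translate `T * t₀` contains none.
  refine ⟨T ∪ N * N * W, fun b => if b then {w | ∃ t ∈ T, θ w t} else
    {w | ∃ t₀ ∈ N * N * W, ∀ t ∈ T, ¬ θ w (t * t₀)}, ?_, ?_, ?_⟩
  · intro b
    cases b
    · refine isClosed_setOf_finite_dependence (Q * (T * (N * N * W)))⁻¹ _ fun w w' h => ?_
      refine exists_congr fun t₀ => and_congr_right fun ht₀ => forall₂_congr fun t ht => ?_
      refine not_congr (hθ w w' _ fun v hv i hi => h _ (Finset.inv_mem_inv ?_))
      exact Finset.mul_mem_mul (hcQ i hi v hv) (Finset.mul_mem_mul ht ht₀)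
    · refine isClosed_setOf_finite_dependence (Q * T)⁻¹ _ fun w w' h => ?_
      refine exists_congr fun t => and_congr_right fun ht => ?_
      exact hθ w w' _ fun v hv i hi => h _ (Finset.inv_mem_inv
        (Finset.mul_mem_mul (hcQ i hi v hv) ht))
  · intro w h0 ht
    have h2 := h0 1
    rw [shift_one] at h2
    obtain ⟨t₀, -, h2⟩ := h2
    obtain ⟨t, ht, h3⟩ := ht t₀
    refine h2 t ht fun i hi => ?_
    have h4 := h3 i hi
    have h5 : ∀ v, shift t₀ w (v * c i * t)⁻¹ = w (v * c i * (t * t₀))⁻¹ := fun v => by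
      simp [shift, mul_assoc]
    simpa only [h5] using h4
  · intro b
    cases b
    · refine Forces.mono (W₁ := N * N * W) ?_ Finset.subset_union_right
      intro X _ _ _ _ hfree A R hA hR hW
      obtain ⟨R', hsub, hR', hsyn, hsparse⟩ := exists_sparse_syndetic_subset hfree hR hW
        (N * N) (by simpa using Finset.mul_mem_mul hN1 hN1) (hsymm N hNinv)
      obtain ⟨A', hA', hoff, hB⟩ := exists_odd_modification hfree hA hR hR' hW hNinv hN1 hcN hcinj
        hsparse hTc
      refine ⟨A', R', hA', hR', hsub, hsyn, hoff, fun B hBA x => ?_⟩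
      obtain ⟨t₀, ht₀, hx⟩ := hsyn x
      refine ⟨t₀, ht₀, fun t ht h => ?_⟩
      obtain ⟨i, hi, h2⟩ := hB B hBA _ hx t ht
      refine h2 ?_
      have h3 := (hθcode B x _).mp h i hi
      simpa only [← mul_smul, mul_assoc] using h3
    · refine Forces.mono (W₁ := T) ?_ Finset.subset_union_left
      intro X _ _ _ _ hfree A R hA hR hW
      have hQ2 : ∀ q ∈ Q, q ∈ Q * Q := fun q hq => by simpa using Finset.mul_mem_mul hq h1
      obtain ⟨R', hsub, hR', hsyn, hsparse⟩ := exists_sparse_syndetic_subset hfree hR hW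
        (Q * Q) (hQ2 1 h1) (hsymm Q hinv)
      obtain ⟨A', hA', hoff, hB⟩ := exists_even_modification hfree hA hR hR' hW hinv hcQ hcinj
        hsparse (fun y hy i hi w hw h => hc1 i w hw
          (hsparse y hy _ (hQ2 _ (hcQ i hi w hw)) h))
      refine ⟨A', R', hA', hR', hsub, hT ▸ hsyn, hoff, fun B hBA x => ?_⟩
      obtain ⟨t, ht, hx⟩ := hsyn x
      refine ⟨t, hT ▸ ht, (hθcode B x t).mpr fun i hi => ?_⟩
      have h2 := hB B hBA _ hx i hi
      simpa only [← mul_smul] using h2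

end

/-! ### The universal family -/

section

variable {G : Type u} [Group G]

theorem exists_forces_aperiodic_bit [Countable G] [Infinite G] (W : Finset G) {s : G}
    (hs : s ≠ 1) :
    ∃ (W' : Finset G) (C : Bool → Set (G → Bool)), (∀ b, IsClosed (C b)) ∧
      (∀ b, ∀ w ∈ C b, shift s w ≠ w) ∧
      (∀ w, (∀ g, shift g w ∈ C false) → (∀ g, shift g w ∈ C true) → False) ∧
      ∀ b, Forces.{u, v} W W' (C b) := by
  obtain ⟨W₁, C, hC, hs, hF⟩ := exists_forces_aperiodic.{u, v} W hs
  obtain ⟨W₂, D, hD, hdisj, hF'⟩ := exists_forces_bit.{u, v} W₁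
  exact ⟨W₂, fun b => C ∩ D b, fun b => hC.inter (hD b), fun b w hw => hs w hw.1,
    fun w h h' => hdisj w (fun g => (h g).2) fun g => (h' g).2, fun b => hF.inter (hF' b)⟩

/-- Both bits lead to the same next window, so one sequence `W` serves all branches `a`. -/
theorem exists_forces_sequence (G : Type u) [Group G] [Countable G] [Infinite G] :
    ∃ (W : ℕ → Finset G) (C : ℕ → Bool → Set (G → Bool)), W 0 = {1} ∧
      (∀ n b, IsClosed (C n b)) ∧
      (∀ g : G, g ≠ 1 → ∃ n, ∀ b, ∀ w ∈ C n b, shift g w ≠ w) ∧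
      (∀ n w, (∀ g, shift g w ∈ C n false) → (∀ g, shift g w ∈ C n true) → False) ∧
      ∀ n b, Forces.{u, v} (W n) (W (n + 1)) (C n b) := by
  have : Nonempty {g : G // g ≠ 1} := by
    obtain ⟨g, hg⟩ := exists_ne (1 : G)
    exact ⟨⟨g, hg⟩⟩
  obtain ⟨s, hs⟩ := exists_surjective_nat {g : G // g ≠ 1}
  choose next C hC hper hdisj hF using fun (W : Finset G) (s : {g : G // g ≠ 1}) =>
    exists_forces_aperiodic_bit.{u, v} W s.2
  let W : ℕ → Finset G := fun n => Nat.rec {1} (fun k W => next W (s k)) n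
  refine ⟨W, fun n => C (W n) (s n), rfl, fun n => hC _ _, fun g hg => ?_, fun n => hdisj _ _,
    fun n => hF _ _⟩
  obtain ⟨n, hn⟩ := hs ⟨g, hg⟩
  refine ⟨n, fun b w hw => ?_⟩
  have := hper _ _ b w hw
  rwa [hn] at this

theorem exists_code_mem {X : Type v} [MeasurableSpace X] [StandardBorelSpace X] [MulAction G X]
    [MeasurableConstSMul G X] (hfree : IsFreeAction G X) {W : ℕ → Finset G} (hW0 : W 0 = {1})
    {E : ℕ → Set (G → Bool)} (hE : ∀ n, Forces.{u, v} (W n) (W (n + 1)) (E n)) :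
    ∃ B : Set X, MeasurableSet B ∧ ∀ n x, code B x ∈ E n := by
  let St : ℕ → Type v := fun n =>
    {p : Set X × Set X // MeasurableSet p.1 ∧ MeasurableSet p.2 ∧ IsSyndetic (W n) p.2}
  have step : ∀ n (p : St n), ∃ p' : St (n + 1), p'.1.2 ⊆ p.1.2 ∧
      (∀ x ∉ p.1.2, (x ∈ p'.1.1 ↔ x ∈ p.1.1)) ∧
      ∀ B : Set X, (∀ x ∉ p'.1.2, (x ∈ B ↔ x ∈ p'.1.1)) → ∀ x, code B x ∈ E n := by
    rintro n ⟨⟨A, R⟩, hA, hR, hsyn⟩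
    obtain ⟨A', R', hA', hR', hsub, hsyn', hoff, hB⟩ := hE n X hfree A R hA hR hsyn
    exact ⟨⟨⟨A', R'⟩, hA', hR', hsyn'⟩, hsub, hoff, hB⟩
  choose next hsub hoff hcode using step
  -- Initially every point is undecided, which is syndetic for the window `{1}`.
  let p : ∀ n, St n := fun n => Nat.rec
    ⟨(∅, Set.univ), MeasurableSet.empty, MeasurableSet.univ, fun _ => ⟨1, by simp [hW0]⟩⟩
    (fun k q => next k q) n
  obtain ⟨B, hB, hlim⟩ := exists_limit (A := fun n => (p n).1.1) (U := fun n => (p n).1.2)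
    (fun n => (p n).2.1) (fun n => (p n).2.2.1) (fun n => hsub n (p n)) (fun n => hoff n (p n))
  exact ⟨B, hB, fun n x => hcode n (p n) B (fun x hx => hlim (n + 1) x hx) x⟩

theorem measurable_code {X : Type v} [MeasurableSpace X] [MulAction G X]
    [MeasurableConstSMul G X] {B : Set X} (hB : MeasurableSet B) :
    Measurable fun x : X => (code B x : G → Bool) := by
  refine measurable_pi_iff.mpr fun g => measurable_to_bool ?_
  have : (fun x : X => code B x g) ⁻¹' {true} = {x | g⁻¹ • x ∈ B} := by
    ext x; simp [code]
  rw [this]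
  exact measurableSet_smul_mem hB _

theorem isFreeAction_freePart : IsFreeAction G (freePart G) := by
  intro g x h
  by_contra hg
  exact x.2 g hg (congrArg Subtype.val h)

theorem isFreeAction_of_stabilizer {X : Type v} [MulAction G X]
    (h : ∀ x : X, MulAction.stabilizer G x = ⊥) : IsFreeAction G X := by
  intro g x hg
  have : g ∈ MulAction.stabilizer G x := hg
  rwa [h x, Subgroup.mem_bot] at this

theorem isClassBijective_of_equivariant {X : Type v} [MulAction G X] {K : Set (freePart G)}
    (f : X → K) (hf : ∀ (g : G) (x : X), (f (g • x) : freePart G) = g • (f x : freePart G)) :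
    IsClassBijective (MulAction.orbitRel G X) (orbitFOn K) f := by
  have h1 : ∀ x x' : X, MulAction.orbitRel G X x x' → orbitFOn K (f x) (f x') := by
    rintro x x' ⟨g, rfl⟩
    exact ⟨g, (hf g x').symm⟩
  refine ⟨h1, fun x => ⟨fun x' hx' => h1 x' x hx', ?_, ?_⟩⟩
  · rintro _ ⟨g, rfl⟩ _ ⟨h, rfl⟩ he
    have h2 : g • (f x : freePart G) = h • (f x : freePart G) := by
      rw [← hf, ← hf]
      exact congrArg Subtype.val he
    obtain rfl := isFreeAction_freePart.smul_left_inj h2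
    rfl
  · rintro y ⟨g, hg⟩
    refine ⟨g • x, ⟨g, rfl⟩, Subtype.ext ?_⟩
    rw [hf]
    exact hg

/-- The points of `Free(2^G)` all of whose shifts lie in every `E n`. -/
def orbitCore (E : ℕ → Set (G → Bool)) : Set (freePart G) :=
  {w | ∀ n g, shift g w.1 ∈ E n}

theorem receivesFreeActions_orbitCore {W : ℕ → Finset G} (hW0 : W 0 = {1})
    {E : ℕ → Set (G → Bool)} (hE : ∀ n, Forces.{u, v} (W n) (W (n + 1)) (E n))
    (hper : ∀ g : G, g ≠ 1 → ∃ n, ∀ w ∈ E n, shift g w ≠ w) :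
    ReceivesFreeActions.{u, v} (orbitCore E) := by
  intro X _ _ _ hmeas hstab
  have : MeasurableConstSMul G X := ⟨hmeas⟩
  obtain ⟨B, hB, hcode⟩ := exists_code_mem (isFreeAction_of_stabilizer hstab) hW0 hE
  have hfree : ∀ x : X, (code B x : G → Bool) ∈ freePart G := by
    intro x g hg
    obtain ⟨n, hn⟩ := hper g hg
    exact hn _ (hcode n x)
  let f : X → orbitCore E := fun x => ⟨⟨code B x, hfree x⟩, fun n g => by
    change shift g (code B x) ∈ E n
    rw [← code_smul]
    exact hcode n _⟩
  have hf : ∀ (g : G) (x : X), (f (g • x) : freePart G) = g • (f x : freePart G) :=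
    fun g x => Subtype.ext (code_smul B x g)
  exact ⟨f, ((measurable_code hB).subtype_mk).subtype_mk, hf, isClassBijective_of_equivariant f hf⟩

/-- A standard Borel space is Borel isomorphic to a Borel subset of the Cantor space, and the action
is transported there. Thus one family built in universe 0 serves every universe. -/
theorem ReceivesFreeActions.lift {K : Set (freePart G)} (hK : ReceivesFreeActions.{u, 0} K) :
    ReceivesFreeActions.{u, v} K := by
  intro X _ _ _ hmeas hstab
  obtain ⟨e, he, hinj⟩ := MeasurableSpace.measurable_injection_nat_bool_of_countablySeparated X
  have hemb : MeasurableEmbedding e := he.measurableEmbedding hinj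
  let φ : X ≃ᵐ Set.range e := hemb.equivRange
  have : StandardBorelSpace (Set.range e) := hemb.measurableSet_range.standardBorel
  let : MulAction G (Set.range e) :=
    { smul := fun g y => φ (g • φ.symm y)
      one_smul := fun y => by
        change φ ((1 : G) • φ.symm y) = y
        simp
      mul_smul := fun g h y => by
        change φ ((g * h) • φ.symm y) = φ (g • φ.symm (φ (h • φ.symm y)))
        simp [mul_smul] }
  have hsmul : ∀ (g : G) (x : X), g • φ x = φ (g • x) := fun g x => by
    change φ (g • φ.symm (φ x)) = φ (g • x)
    simp
  obtain ⟨f, hf, heq, -⟩ := hK (Set.range e)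
    (fun g => φ.measurable.comp ((hmeas g).comp φ.symm.measurable))
    (fun y => by
      obtain ⟨x, rfl⟩ := φ.surjective y
      ext g
      rw [MulAction.mem_stabilizer_iff, hsmul, φ.injective.eq_iff, ← MulAction.mem_stabilizer_iff,
        hstab x])
  have heq' : ∀ (g : G) (x : X), (f (φ (g • x)) : freePart G) = g • (f (φ x) : freePart G) :=
    fun g x => by rw [← hsmul, heq]
  exact ⟨fun x => f (φ x), hf.comp φ.measurable, heq',
    isClassBijective_of_equivariant (fun x => f (φ x)) heq'⟩

theorem IsBorelStructurable.pullback {L : FirstOrder.Language.{0, 0}} [L.IsRelational]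
    {𝒦 : Set (Bundled.{0} L.Structure)} {X Y : Type u} [MeasurableSpace X] [MeasurableSpace Y]
    {E : Setoid X} {F : Setoid Y} (hE : MeasurableSet {p : X × X | E p.1 p.2}) {f : X → Y}
    (hf : Measurable f) (hbij : IsClassBijective E F f) (h : IsBorelStructurable L 𝒦 F) :
    IsBorelStructurable L 𝒦 E := by
  obtain ⟨Q, hQ, -, hK⟩ := h
  -- Pulled-back tuples might join different `E`-classes with the same image class; requiring
  -- `E`-equivalence removes them.
  let Q' : ∀ n : ℕ, L.Relations n → Set (Fin n → X) := fun n R =>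
    {a | (∀ i j, E (a i) (a j)) ∧ (fun i => f (a i)) ∈ Q n R}
  refine ⟨Q', fun n R => ?_, fun n R a ha => ha.1, fun x => ?_⟩
  · have h1 : MeasurableSet {a : Fin n → X | ∀ i j, E (a i) (a j)} := by
      have : {a : Fin n → X | ∀ i j, E (a i) (a j)} =
          ⋂ i, ⋂ j, (fun a : Fin n → X => (a i, a j)) ⁻¹' {p : X × X | E p.1 p.2} := by
        ext a; simp
      rw [this]
      exact MeasurableSet.iInter fun i => MeasurableSet.iInter fun j =>
        ((measurable_pi_apply i).prodMk (measurable_pi_apply j)) hE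
    have h2 : Measurable fun (a : Fin n → X) (i : Fin n) => f (a i) :=
      measurable_pi_iff.mpr fun i => hf.comp (measurable_pi_apply i)
    exact h1.inter (h2 (hQ n R))
  · obtain ⟨M, hM, ⟨φ⟩⟩ := hK (f x)
    refine ⟨M, hM, ?_⟩
    let := restrictedStructure L Q' {y | E y x}
    let := restrictedStructure L Q {y | F y (f x)}
    let e : {y | E y x} ≃ {y | F y (f x)} := (hbij.2 x).equiv f
    have he : ∀ y, (e y : Y) = f y := fun y => rfl
    refine ⟨FirstOrder.Language.Equiv.comp φ ⟨e, fun g => isEmptyElim g, fun {n} R a => ?_⟩⟩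
    change (fun i => (e (a i) : Y)) ∈ Q n R ↔
      (∀ i j, E (a i) (a j)) ∧ (fun i => f (a i)) ∈ Q n R
    simp only [he]
    exact ⟨fun h => ⟨fun i j => E.trans (a i).2 (E.symm (a j).2), h⟩, fun h => h.2⟩

theorem measurable_shift (g : G) : Measurable (shift g : (G → Bool) → G → Bool) :=
  measurable_pi_iff.mpr fun _ => measurable_pi_apply _

theorem continuous_shift (g : G) : Continuous (shift g : (G → Bool) → G → Bool) :=
  continuous_pi fun _ => continuous_apply _

theorem measurable_smul_freePart (g : G) : Measurable fun w : freePart G => g • w :=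
  ((measurable_shift g).comp measurable_subtype_coe).subtype_mk

theorem measurableSet_freePart [Countable G] : MeasurableSet (freePart G) := by
  have : freePart G = ⋂ g : G, ⋂ _ : g ≠ 1, {w | shift g w = w}ᶜ := by
    ext w; simp [freePart]
  rw [this]
  exact MeasurableSet.iInter fun g => MeasurableSet.iInter fun _ =>
    (measurableSet_eq_fun (measurable_shift g) measurable_id).compl

theorem measurableSet_orbitF [Countable G] :
    MeasurableSet {p : freePart G × freePart G | orbitF G p.1 p.2} := by
  have := (measurableSet_freePart (G := G)).standardBorel
  have h : {p : freePart G × freePart G | orbitF G p.1 p.2} =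
      ⋃ g : G, {p | g • p.2 = p.1} := by
    ext p
    simp only [Set.mem_iUnion]
    rfl
  rw [h]
  exact MeasurableSet.iUnion fun g =>
    measurableSet_eq_fun ((measurable_smul_freePart g).comp measurable_snd) measurable_fst

theorem ReceivesFreeActions.achievesStructurability [Countable G] {K : Set (freePart G)}
    (hK : ReceivesFreeActions.{u, u} K) (hinv : IsGInvariant G K) : AchievesStructurability K := by
  have := (measurableSet_freePart (G := G)).standardBorel
  intro L _ _ 𝒦 _ _
  constructor
  · intro h
    obtain ⟨f, hf, -, hbij⟩ := hK (freePart G) measurable_smul_freePart (fun x => by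
      rw [eq_bot_iff]
      intro g hg
      exact isFreeAction_freePart g x hg)
    exact h.pullback measurableSet_orbitF hf hbij
  · intro h
    have hbij : IsClassBijective (orbitFOn K) (orbitF G) (Subtype.val : K → freePart G) := by
      refine ⟨fun x x' h => h, fun x => ⟨fun x' h => h, Subtype.val_injective.injOn, ?_⟩⟩
      rintro y ⟨g, rfl⟩
      exact ⟨⟨g • x.1, hinv g x.1 x.2⟩, ⟨g, rfl⟩, rfl⟩
    exact h.pullback (((measurable_subtype_coe.comp measurable_fst).prodMk
      (measurable_subtype_coe.comp measurable_snd)) measurableSet_orbitF) measurable_subtype_coe hbij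

/-- A family of pairwise disjoint nonempty compact invariant subsets of `Free(2^G)`, indexed by
the Cantor space and with compact graph, each of which receives all free Borel actions. -/
structure UniversalFamily (G : Type u) [Group G] where
  K : (ℕ → Bool) → Set (freePart G)
  isCompactInvariant : ∀ a, IsCompactInvariant (K a)
  nonempty : ∀ a, (K a).Nonempty
  disjoint : ∀ a b, a ≠ b → Disjoint (K a) (K b)
  isCompact_graph : IsCompact {p : (ℕ → Bool) × freePart G | p.2 ∈ K p.1}
  receives : ∀ a, ReceivesFreeActions.{u, 0} (K a)

/-- Apply the property to the free translation action of `G` on itself. -/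
theorem ReceivesFreeActions.nonempty [Countable G] {K : Set (freePart G)}
    (hK : ReceivesFreeActions.{u, u} K) : K.Nonempty := by
  let : MeasurableSpace G := ⊤
  obtain ⟨f, -⟩ := hK G (fun g => measurable_from_top) (fun x => by
    rw [eq_bot_iff]
    intro g hg
    exact mul_eq_right.mp (show g * x = x from hg))
  exact ⟨f 1, (f 1).2⟩

theorem exists_universalFamily (G : Type u) [Group G] [Countable G] [Infinite G] :
    Nonempty (UniversalFamily G) := by
  obtain ⟨W, C, hW0, hC, hper, hdisj, hF⟩ := exists_forces_sequence.{u, 0} G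
  have hrec : ∀ a : ℕ → Bool, ReceivesFreeActions.{u, 0} (orbitCore fun n => C n (a n)) :=
    fun a => receivesFreeActions_orbitCore hW0 (fun n => hF n (a n)) fun g hg =>
      (hper g hg).imp fun n hn => hn (a n)
  have hgraph : IsCompact {p : (ℕ → Bool) × freePart G | p.2 ∈ orbitCore fun n => C n (p.1 n)} := by
    have hemb : Topology.IsEmbedding (Prod.map id Subtype.val :
        (ℕ → Bool) × freePart G → (ℕ → Bool) × (G → Bool)) :=
      Topology.IsEmbedding.id.prodMap Topology.IsEmbedding.subtypeVal
    rw [hemb.isCompact_iff]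
    -- The closed conditions already force freeness, so the graph is closed in the compact space `(ℕ
    -- → Bool) × (G → Bool)`, not merely relative to the free part.
    have himg : Prod.map id Subtype.val ''
        {p : (ℕ → Bool) × freePart G | p.2 ∈ orbitCore fun n => C n (p.1 n)} =
        ⋂ n, ⋂ g : G, ⋃ b : Bool, {p : (ℕ → Bool) × (G → Bool) | p.1 n = b} ∩
          {p | shift g p.2 ∈ C n b} := by
      ext ⟨a, w⟩
      simp only [Set.mem_image, Set.mem_iInter, Set.mem_iUnion, Set.mem_inter_iff,
        Set.mem_ofPred_eq, exists_eq_left']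
      constructor
      · rintro ⟨⟨a, w⟩, h, he⟩
        cases he
        exact h
      · intro h
        refine ⟨(a, ⟨w, fun g hg => ?_⟩), h, rfl⟩
        obtain ⟨n, hn⟩ := hper g hg
        have := h n 1
        rw [shift_one] at this
        exact hn _ w this
    rw [himg]
    refine IsClosed.isCompact (isClosed_iInter fun n => isClosed_iInter fun g =>
      isClosed_iUnion_of_finite fun b => IsClosed.inter ?_ ?_)
    · exact isClosed_eq ((continuous_apply n).comp continuous_fst) continuous_const
    · exact (hC n b).preimage ((continuous_shift g).comp continuous_snd)
  refine ⟨⟨fun a => orbitCore fun n => C n (a n), fun a => ⟨?_, ?_⟩, fun a =>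
    ((hrec a).lift).nonempty, fun a b hab => ?_, hgraph, hrec⟩⟩
  · have h1 : (orbitCore fun n => C n (a n)) = Prod.snd ''
        ({p : (ℕ → Bool) × freePart G | p.2 ∈ orbitCore fun n => C n (p.1 n)} ∩ {p | p.1 = a}) := by
      ext w
      constructor
      · exact fun h => ⟨(a, w), ⟨h, rfl⟩, rfl⟩
      · rintro ⟨⟨a, w⟩, ⟨h, rfl⟩, rfl⟩
        exact h
    rw [h1]
    exact (hgraph.inter_right (isClosed_eq continuous_fst continuous_const)).image continuous_snd
  · intro g w hw n h
    change shift h (shift g w.1) ∈ _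
    rw [← shift_mul]
    exact hw n _
  · rw [Set.disjoint_left]
    intro w hwa hwb
    obtain ⟨n, hn⟩ := Function.ne_iff.mp hab
    have ha := hwa n
    have hb := hwb n
    cases h1 : a n <;> cases h2 : b n <;> simp only [h1, h2] at ha hb hn
    · exact hn rfl
    · exact hdisj n _ ha hb
    · exact hdisj n _ hb ha
    · exact hn rfl

end

/-! ### Perfect subfamilies and Baire category -/

theorem neBot_nhdsNE_cantor (a : ℕ → Bool) : Filter.NeBot (nhdsWithin a {a}ᶜ) := by
  have h : Filter.Tendsto (fun n => Function.update a n (!a n)) Filter.atTop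
      (nhdsWithin a {a}ᶜ) := by
    refine tendsto_nhdsWithin_iff.mpr ⟨tendsto_pi_nhds.mpr fun i => ?_, .of_forall fun n h => ?_⟩
    · refine tendsto_const_nhds.congr' ?_
      filter_upwards [Filter.eventually_gt_atTop i] with n hn
      rw [Function.update_of_ne hn.ne]
    · have := congrFun h n
      simp at this
  exact h.neBot

theorem not_countable_of_dense_isGδ {S : Set (ℕ → Bool)} (hS : IsGδ S) (hd : Dense S) :
    ¬ S.Countable := by
  intro hc
  have h1 : Dense (S ∩ ⋂ a ∈ S, ({a}ᶜ : Set (ℕ → Bool))) := by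
    refine hd.inter_of_Gδ hS (IsGδ.biInter hc fun a _ => isOpen_compl_singleton.isGδ) ?_
    exact dense_biInter_of_isOpen (fun a _ => isOpen_compl_singleton) hc fun a _ =>
      have := neBot_nhdsNE_cantor a
      dense_compl_singleton a
  obtain ⟨a, ha, ha'⟩ := h1.nonempty
  exact Set.mem_iInter₂.mp ha' a ha rfl

/-- In a finer Polish topology `S` is closed and uncountable, so it contains an injective image of
the Cantor space; continuity survives coarsening the target. -/
theorem exists_cantor_embedding_of_dense_isGδ {S : Set (ℕ → Bool)} (hS : IsGδ S) (hd : Dense S) :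
    ∃ γ : (ℕ → Bool) → ℕ → Bool, Continuous γ ∧ Function.Injective γ ∧ ∀ a, γ a ∈ S := by
  have : PolishSpace (ℕ → Bool) := {}
  obtain ⟨t', hle, hpol, hclosed, -⟩ := hS.measurableSet.isClopenable
  obtain ⟨γ, hγ, hcont, hinj⟩ :=
    @IsClosed.exists_nat_bool_injection_of_not_countable _ t' hpol _ hclosed
      (not_countable_of_dense_isGδ hS hd)
  exact ⟨γ, continuous_le_rng hle hcont, hinj, fun a => hγ ⟨a, rfl⟩⟩

/-- A family of sets over the Cantor space with compact graph becomes Vietoris continuous on the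
image of some continuous injection. -/
theorem exists_continuous_subfamily {X : Type u} [TopologicalSpace X] [T3Space X]
    [SecondCountableTopology X] {K : (ℕ → Bool) → Set X} (hK : ∀ a, IsCompact (K a))
    (hgraph : IsCompact {p : (ℕ → Bool) × X | p.2 ∈ K p.1}) :
    ∃ γ : (ℕ → Bool) → ℕ → Bool, Function.Injective γ ∧
      Continuous fun t => (⟨K (γ t), hK (γ t)⟩ : Compacts X) := by
  let H : Set X → Set (ℕ → Bool) := fun U => {a | (K a ∩ U).Nonempty}
  have hH : ∀ U, IsClosed U → IsClosed (H U) := by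
    intro U hU
    have : H U = Prod.fst '' ({p : (ℕ → Bool) × X | p.2 ∈ K p.1} ∩ {p | p.2 ∈ U}) := by
      ext a
      constructor
      · rintro ⟨x, hx, hxU⟩
        exact ⟨(a, x), ⟨hx, hxU⟩, rfl⟩
      · rintro ⟨⟨a, x⟩, ⟨hx, hxU⟩, rfl⟩
        exact ⟨x, hx, hxU⟩
    rw [this]
    exact ((hgraph.inter_right (hU.preimage continuous_snd)).image continuous_fst).isClosed
  -- Compactness of the graph gives only upper semicontinuity. Off the nowhere dense frontiers,
  -- hitting `closure b` is also an open condition, which gives the lower half.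
  obtain ⟨S, hS⟩ : ∃ S, S = ⋂ b ∈ countableBasis X, (frontier (H (closure b)))ᶜ := ⟨_, rfl⟩
  have hopen : ∀ b : Set X, IsOpen (frontier (H (closure b)))ᶜ := fun b =>
    isClosed_frontier.isOpen_compl
  obtain ⟨γ, hγ, hinj, hmem⟩ := exists_cantor_embedding_of_dense_isGδ (S := S)
    (hS ▸ IsGδ.biInter (countable_countableBasis X) fun b _ => (hopen b).isGδ)
    (hS ▸ dense_biInter_of_isOpen (fun b _ => hopen b) (countable_countableBasis X) fun b _ =>
      interior_eq_empty_iff_dense_compl.mp (interior_frontier (hH _ isClosed_closure)))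
  refine ⟨γ, hinj, ?_⟩
  refine continuous_induced_rng.mpr (continuous_generateFrom_iff.mpr ?_)
  rintro _ (⟨U, hU, rfl⟩ | ⟨U, hU, rfl⟩)
  · have : (fun t => K (γ t)) ⁻¹' 𝒫 U = γ ⁻¹' (H Uᶜ)ᶜ := by
      ext t
      simp only [H, Set.mem_preimage, Set.mem_powerset_iff, Set.mem_compl_iff, Set.mem_ofPred_eq,
        Set.inter_compl_nonempty_iff, not_not]
    exact (congrArg IsOpen this).mpr ((hH _ hU.isClosed_compl).isOpen_compl.preimage hγ)
  · have : (fun t => K (γ t)) ⁻¹' {s | (s ∩ U).Nonempty} =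
        ⋃ b ∈ {b ∈ countableBasis X | closure b ⊆ U}, γ ⁻¹' interior (H (closure b)) := by
      ext t
      simp only [Set.mem_preimage, Set.mem_ofPred_eq, Set.mem_iUnion, exists_prop]
      constructor
      · rintro ⟨x, hx, hxU⟩
        obtain ⟨b, ⟨hb, hxb⟩, hbU⟩ := ((isBasis_countableBasis X).nhds_basis_closure x).mem_iff.mp
          (hU.mem_nhds hxU)
        refine ⟨b, ⟨hxb, hbU⟩, ?_⟩
        by_contra hn
        have h1 := hmem t
        rw [hS] at h1
        refine Set.mem_iInter₂.mp h1 b hxb ⟨subset_closure ?_, hn⟩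
        exact ⟨x, hx, subset_closure hb⟩
      · rintro ⟨b, ⟨hb, hbU⟩, ht⟩
        obtain ⟨x, hx, hxb⟩ := interior_subset ht
        exact ⟨x, hx, hbU hxb⟩
    refine (congrArg IsOpen this).mpr ?_
    exact isOpen_biUnion fun b _ => isOpen_interior.preimage hγ

theorem perfect_range_of_injective {Y : Type u} [TopologicalSpace Y] [T2Space Y]
    {f : (ℕ → Bool) → Y} (hf : Continuous f) (hinj : Function.Injective f) :
    Perfect (Set.range f) := by
  refine ⟨(isCompact_range hf).isClosed, ?_⟩
  rintro _ ⟨a, rfl⟩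
  have h1 : AccPt a (Filter.principal Set.univ) := by
    rw [AccPt, Filter.principal_univ, inf_top_eq]
    exact neBot_nhdsNE_cantor a
  simpa using h1.map hf.continuousAt hinj

/-- Modulo meager sets each nonmeager `K i` is a nonempty open set. By Baire category these open
sets are disjoint, and second countability makes them countably many. -/
theorem countable_setOf_not_isMeagre {X : Type u} {ι : Type*} [TopologicalSpace X]
    [SecondCountableTopology X] [BaireSpace X] {K : ι → Set X} (hK : ∀ i, BaireMeasurableSet (K i))
    (hdisj : ∀ i j, i ≠ j → Disjoint (K i) (K j)) : {i | ¬ IsMeagre (K i)}.Countable := by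
  choose O hO hKO using fun i => (hK i).residualEq_isOpen
  have hne : ∀ i, ¬ IsMeagre (K i) → (O i).Nonempty := by
    intro i hi
    by_contra hn
    rw [Set.not_nonempty_iff_eq_empty] at hn
    refine hi ?_
    have := hKO i
    rw [hn] at this
    filter_upwards [this] with x hx
    exact fun h => (hx.mp h : x ∈ (∅ : Set X))
  have hdisj' : ∀ i j, i ≠ j → Disjoint (O i) (O j) := by
    intro i j hij
    rw [Set.disjoint_iff_inter_eq_empty]
    by_contra hn
    refine not_isMeagre_of_isOpen ((hO i).inter (hO j)) (Set.nonempty_iff_ne_empty.mpr hn) ?_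
    have h1 := hKO i
    have h2 := hKO j
    filter_upwards [h1, h2] with x hx hx'
    exact fun h => Set.disjoint_left.mp (hdisj i j hij) (hx.mpr h.1) (hx'.mpr h.2)
  refine Set.PairwiseDisjoint.countable_of_isOpen (s := O) ?_ (fun i _ => hO i)
    fun i hi => hne i hi
  exact fun i _ j _ hij => hdisj' i j hij

/-! ### Conclusion -/

section

variable {G : Type u} [Group G]

theorem UniversalFamily.achieves [Countable G] (F : UniversalFamily G) (a : ℕ → Bool) :
    ReceivesFreeActions.{u, v} (F.K a) ∧ AchievesStructurability (F.K a) :=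
  ⟨(F.receives a).lift, ((F.receives a).lift).achievesStructurability (F.isCompactInvariant a).2⟩

theorem UniversalFamily.measurableSet [Countable G] (F : UniversalFamily G) (a : ℕ → Bool) :
    MeasurableSet (F.K a) :=
  (F.isCompactInvariant a).1.isClosed.measurableSet

theorem UniversalFamily.exists_perfect [Countable G] (F : UniversalFamily G) :
    ∃ P : Set (Compacts (freePart G)), P.Nonempty ∧ Perfect P ∧
      (∀ C ∈ P, ∃ a, (C : Set (freePart G)) = F.K a) := by
  obtain ⟨γ, hinj, hcont⟩ := exists_continuous_subfamily (fun a => (F.isCompactInvariant a).1)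
    F.isCompact_graph
  refine ⟨_, Set.range_nonempty _, perfect_range_of_injective hcont fun t t' h => ?_, ?_⟩
  · have h1 : F.K (γ t) = F.K (γ t') := congrArg (SetLike.coe : Compacts (freePart G) → _) h
    by_contra hne
    have h2 := F.disjoint _ _ (hinj.ne hne)
    rw [h1, disjoint_self] at h2
    exact (F.nonempty (γ t')).ne_empty h2
  · rintro _ ⟨t, rfl⟩
    exact ⟨γ t, rfl⟩

theorem not_countable_univ_cantor : ¬ (Set.univ : Set (ℕ → Bool)).Countable :=
  not_countable_of_dense_isGδ IsGδ.univ dense_univ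

end

end FreeShift

open FreeShift in
theorem mainTheorem3 (G : Type u) [Group G] [Countable G] [Infinite G] :
    (∀ I : Order.Ideal (Set (freePart G)),
      (∀ P : Set (Compacts (freePart G)), P.Nonempty → Perfect P →
        (∀ C ∈ P, IsGInvariant G (C : Set (freePart G))) →
        (∀ C ∈ P, ∀ D ∈ P, C ≠ D → Disjoint (C : Set (freePart G)) (D : Set (freePart G))) →
        ∃ C ∈ P, (C : Set (freePart G)) ∈ I) →
      ∃ K : Set (freePart G), IsCompactInvariant K ∧ K ∈ I ∧
        ReceivesFreeActions.{u, v} K ∧ AchievesStructurability K) ∧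
    (∀ μ : Measure (freePart G), IsProbabilityMeasure μ →
      ∃ K : Set (freePart G), IsCompactInvariant K ∧ μ K = 0 ∧
        ReceivesFreeActions.{u, v} K ∧ AchievesStructurability K) ∧
    (∀ τ : TopologicalSpace (freePart G), @PolishSpace (freePart G) τ →
      @BorelSpace (freePart G) τ inferInstance →
      ∃ K : Set (freePart G), IsCompactInvariant K ∧ @IsMeagre (freePart G) τ K ∧
        ReceivesFreeActions.{u, v} K ∧ AchievesStructurability K) := by
  obtain ⟨F⟩ := exists_universalFamily G
  refine ⟨fun I hI => ?_, fun μ hμ => ?_, fun τ hτ hB => ?_⟩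
  · obtain ⟨P, hne, hP, hPF⟩ := F.exists_perfect
    obtain ⟨C, hC, hCI⟩ := hI P hne hP (fun C hC => by
      obtain ⟨a, ha⟩ := hPF C hC
      rw [ha]
      exact (F.isCompactInvariant a).2) (fun C hC D hD hCD => by
      obtain ⟨a, ha⟩ := hPF C hC
      obtain ⟨b, hb⟩ := hPF D hD
      rw [ha, hb]
      refine F.disjoint a b fun h => hCD (SetLike.coe_injective ?_)
      rw [ha, hb, h])
    obtain ⟨a, ha⟩ := hPF C hC
    exact ⟨F.K a, F.isCompactInvariant a, ha ▸ hCI, F.achieves a⟩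
  · have h := Measure.countable_meas_pos_of_disjoint_iUnion (μ := μ) F.measurableSet
      (fun a b hab => F.disjoint a b hab)
    obtain ⟨a, -, ha⟩ : ∃ a ∈ Set.univ, a ∉ {a | 0 < μ (F.K a)} := by
      by_contra! hn
      exact not_countable_univ_cantor (h.mono hn)
    exact ⟨F.K a, F.isCompactInvariant a, nonpos_iff_eq_zero.mp (not_lt.mp ha), F.achieves a⟩
  · have hmeas : ∀ a, @BaireMeasurableSet _ τ (F.K a) := fun a =>
      @MeasurableSet.baireMeasurableSet _ τ _ _ hB (F.measurableSet a)
    have h := @countable_setOf_not_isMeagre _ _ τ hτ.toSecondCountableTopology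
      (by
        let := @upgradeIsCompletelyMetrizable _ τ hτ.toIsCompletelyMetrizableSpace
        infer_instance) _ hmeas F.disjoint
    obtain ⟨a, -, ha⟩ : ∃ a ∈ Set.univ, a ∉ {a | ¬ @IsMeagre _ τ (F.K a)} := by
      by_contra! hn
      exact not_countable_univ_cantor (h.mono hn)
    exact ⟨F.K a, F.isCompactInvariant a, not_not.mp ha, F.achieves a⟩
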